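/- **Setting.** Let $\Omega\subset\mathbb R^3$ be a bounded open set with piecewise smooth boundary, lying locally on one side of it, with $\partial\Omega=\Gamma_0\sqcup\Gamma_1$ (Borel parts), let $T>0$, $\rho>0$, and let $S$ be a symmetric positive definite linear map of $E=S^2(\mathbb R^3)$ (symmetric tensors, scalar product $a:b$). Let $f(t)\in L^2(\Omega;\mathbb R^3)$ be volume forces, $\bar f(t)\in L^2(\Gamma_1;\mathbb R^3)$ surface forces, $\bar u(t)\in L^2(\Gamma_0;\mathbb R^3)$ imposed displacements. $\nabla u$ denotes the symmetric gradient, and $\langle\cdot,\cdot\rangle$ the $L^2(\Omega)$ scalar product. Displacement fields are the $L^2(\Omega)$-limits $u$ of smooth fields whose strains converge in $L^2(\Omega)$ and whose boundary values converge in $L^2(\partial\Omega)$; these limits are the strain $\nabla u$ and the trace of $u$. A virtual displacement is a displacement field with zero trace on $\Gamma_0$. For $\sigma\in L^2(\Omega;E)$ and $d\in L^2(\Omega;\mathbb R^3)$, "$\nabla\cdot\sigma=d$ in $\Omega$ and $\sigma n=\bar f$ on $\Gamma_1$" means $\langle\sigma,\nabla v\rangle+\langle d,v\rangle=\int_{\Gamma_1}\bar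 f\cdot v\,d\Gamma$ for all virtual displacements $v$. *Bipotentials.* A bipotential for a pairing $\langle\cdot,\cdot\rangle$ of $X$ and $Y$ is a function $b:X\times Y\to\mathbb R\cup\{+\infty\}$, convex and lower semicontinuous in each argument, with $b(x,y)\ge\langle x,y\rangle$ for all $x,y$ and $b(x,y)=\langle x,y\rangle\Leftrightarrow y\in\partial b(\bullet,y)(x)\Leftrightarrow x\in\partial b(x,\bullet)(y)$. On $X\times Y$ let $\omega((x,y),(x',y'))=\langle x,y'\rangle-\langle x',y\rangle$; for $F:X\times Y\to\mathbb R\cup\{+\infty\}$ finite at $z$, let $\partial^\omega F(z)=\{z':F(z+z'')-F(z)\ge\omega(z',z'')\ \forall z''\}$. A symplectic bipotential is a function $\hat b:(X\times Y)^2\to\mathbb R\cup\{+\infty\}$, convex and lower semicontinuous in each argument, with $\hat b(z_I,z)\ge\omega(z_I,z)$ and $\hat b(z_I,z)=\omega(z_I,z)\Leftrightarrow z_I\in\partial^\omega\hat b(z_I,\bullet)(z)\Leftrightarrow -z\in\partial^\omega\hat b(\bullet,z)(z_I)$. Let $b_p:E\times E\to\mathbb R\cup\{+\infty\}$ be a Borel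 measurable bipotential for $a:b$. On $Z=X\times X$, $X=\mathbb R^3\times E$, with elements $z=((u,\varepsilon^p),(p,\pi))$ and $J(x,y)=(y,-x)$, put $$b(z',z)=b_p(\pi',\pi)+I_{\{0\}}(u')+I_{\{0\}}(\varepsilon^{p\prime})+I_{\{0\}}(p'),\qquad \hat b(z_I,z)=b(J^{-1}z_I,z),$$ where $I_{\{0\}}$ is $0$ at $0$ and $+\infty$ elsewhere. *Phase space.* For fields $z=((u,\varepsilon^p),(p,\pi))$ ($u$ a displacement field, the others square integrable) let $\sigma=S^{-1}(\nabla u-\varepsilon^p)$ and $$H(t,z)=\int_\Omega\Big\{\tfrac1{2\rho}|p|^2+\tfrac12(\nabla u-\varepsilon^p):S^{-1}(\nabla u-\varepsilon^p)-f(t)\cdot u\Big\}d\Omega-\int_{\Gamma_1}\bar f(t)\cdot u\,d\Gamma .$$ A square integrable field $X_H$ is the symplectic gradient of $H(t,\cdot)$ at $z$ if $\omega(X_H,\zeta)=\lim_{\epsilon\to0}\epsilon^{-1}(H(t,z+\epsilon\zeta)-H(t,z))$ for all $\zeta$ whose displacement part is virtual. An admissible phase path is a path $z$ of class $H^1$ in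 time on $[0,T]$ (with $u$ of class $H^1$ together with its strain and trace), with $u=\bar u$ on $\Gamma_0$ and a given initial state $z(0)=z_0=((u_0,\varepsilon^p_0),(p_0,\pi_0))$, such that $X_H$ exists for almost every $t$ and is square integrable in time. Put $\dot z_I=\dot z-X_H$, $\hat B(z_I,z)=\int_\Omega\hat b(z_I,z)\,d\Omega$ and $$\Pi(z)=\int_0^T\{\hat B(\dot z_I,\dot z)-\omega(\dot z_I,\dot z)\}\,dt .$$ *Reduced paths.* An admissible path $(u,\sigma)$ consists of $u$ of class $H^1$ in time (with its strain and trace) and $\sigma$ of class $H^1$ in time with values in $L^2(\Omega;E)$, such that $\dot u$ is of class $H^1$ in time with values in $L^2(\Omega;\mathbb R^3)$, $u=\bar u$ on $\Gamma_0$, $u(0)=u_0$, $\sigma(0)=S^{-1}(\nabla u_0-\varepsilon^p_0)$, $\rho\dot u(0)=p_0$ and, for almost every $t$, $\nabla\cdot\sigma+f=\rho\ddot u$ in $\Omega$ and $\sigma n=\bar f$ on $\Gamma_1$. For such paths let $$\Pi(u,\sigma)=\int_0^T\Big\{\hat B(\nabla\dot u-S:\dot\sigma,\sigma)-\langle\nabla\dot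 u-S:\dot\sigma,\sigma\rangle\Big\}dt,\qquad \hat B(e,s)=\int_\Omega b_p(e,s)\,d\Omega .$$ A natural evolution is a couple $(u,\sigma)$ that comes from an admissible phase path $z$ (with $\sigma=S^{-1}(\nabla u-\varepsilon^p)$) satisfying $\dot z_I\in\partial^\omega\hat b(\dot z_I,\bullet)(\dot z)$ almost everywhere in $\Omega$ for almost every $t$. **Theorem (SBEN principle for non associated plasticity).** 1. $b$ is a bipotential on $Z$ for the scalar product $\langle\langle(x,y),(x',y')\rangle\rangle=\langle x,x'\rangle+\langle y,y'\rangle$, and $\hat b$ is a symplectic bipotential. 2. For every admissible phase path, $\Pi(z)\ge0$, with equality if and only if $\dot z_I\in\partial^\omega\hat b(\dot z_I,\bullet)(\dot z)$ almost everywhere in $\Omega$ for almost every $t$. 3. For every admissible phase path, $\Pi(z)=\Pi(u,\sigma)$ if for almost every $t$ the constraints $p=\rho\dot u$, $\nabla\cdot\sigma+f=\dot p$ (with $\sigma n=\bar f$ on $\Gamma_1$) and $\dot\pi=\sigma$ hold, and $\Pi(z)=+\infty$ otherwise. The couples $(u,\sigma)$ that come from admissible phase paths satisfying these constraints are exactly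 the admissible paths. 4. The natural evolutions are exactly the admissible paths $(u,\sigma)$ that satisfy the flow rule $\dot\varepsilon^p\in\partial b_p(\dot\varepsilon^p,\bullet)(\sigma)$, $\dot\varepsilon^p=\nabla\dot u-S:\dot\sigma$, almost everywhere in $\Omega$ for almost every $t$. 5. For every admissible path, $\Pi(u,\sigma)\ge0$, with equality if and only if $(u,\sigma)$ is a natural evolution. Hence every natural evolution minimizes $\Pi(u,\sigma)$ among the admissible paths, and the minimum is zero. -/

import Mathlib

open MeasureTheory Set Filter Topology
open scoped ContDiff ENNReal

noncomputable section

namespace SBEN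

/-! ### Convex analysis: subdifferentials, bipotentials, symplectic bipotentials -/

/-- Convexity of an extended-real-valued function: its epigraph is convex. -/
def EConvex {V : Type*} [AddCommGroup V] [Module ℝ V] (F : V → EReal) : Prop :=
  Convex ℝ {q : V × ℝ | F q.1 ≤ (q.2 : EReal)}

/-- The subdifferential of `F` at a point `v` where `F` is finite, for a pairing `p`
between directions and subgradients: all `d` with `F (v + h) - F v ≥ p h d` for every `h`. -/
def subdiff {V D : Type*} [AddCommGroup V] (p : V → D → ℝ) (F : V → EReal) (v : V) : Set D :=
  {d | F v ≠ ⊤ ∧ F v ≠ ⊥ ∧ ∀ h : V, F v + ((p h d : ℝ) : EReal) ≤ F (v + h)}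

/-- Bipotentials for the duality `pair : X × Y → ℝ`. The value `-∞` is excluded by `fenchel`. -/
structure IsBipotential {X Y : Type*} [AddCommGroup X] [Module ℝ X] [TopologicalSpace X]
    [AddCommGroup Y] [Module ℝ Y] [TopologicalSpace Y]
    (pair : X → Y → ℝ) (b : X → Y → EReal) : Prop where
  convex_left : ∀ y, EConvex (fun x => b x y)
  convex_right : ∀ x, EConvex (fun y => b x y)
  lsc_left : ∀ y, LowerSemicontinuous (fun x => b x y)
  lsc_right : ∀ x, LowerSemicontinuous (fun y => b x y)
  fenchel : ∀ x y, ((pair x y : ℝ) : EReal) ≤ b x y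
  extremal_left : ∀ x y,
    b x y = ((pair x y : ℝ) : EReal) ↔ y ∈ subdiff pair (fun x' => b x' y) x
  extremal_right : ∀ x y,
    b x y = ((pair x y : ℝ) : EReal) ↔ x ∈ subdiff (fun h d => pair d h) (fun y' => b x y') y

/-- The canonical symplectic form `ω((x, y), (x', y')) = ⟨x, y'⟩ - ⟨x', y⟩`. -/
def sympForm {X Y : Type*} (pair : X → Y → ℝ) (z z' : X × Y) : ℝ :=
  pair z.1 z'.2 - pair z'.1 z.2

/-- The symplectic subdifferential `∂^ω F (z)`: all `z'` with
`F (z + z'') - F z ≥ ω (z', z'')` for every `z''`. -/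
def sympSubdiff {X Y : Type*} [AddCommGroup X] [AddCommGroup Y] (pair : X → Y → ℝ)
    (F : X × Y → EReal) (z : X × Y) : Set (X × Y) :=
  subdiff (fun z'' z' => sympForm pair z' z'') F z

/-- Symplectic bipotentials on `X × Y`. -/
structure IsSymplecticBipotential {X Y : Type*} [AddCommGroup X] [Module ℝ X]
    [TopologicalSpace X] [AddCommGroup Y] [Module ℝ Y] [TopologicalSpace Y]
    (pair : X → Y → ℝ) (b : X × Y → X × Y → EReal) : Prop where
  convex_left : ∀ z, EConvex (fun zI => b zI z)
  convex_right : ∀ zI, EConvex (fun z => b zI z)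
  lsc_left : ∀ z, LowerSemicontinuous (fun zI => b zI z)
  lsc_right : ∀ zI, LowerSemicontinuous (fun z => b zI z)
  fenchel : ∀ zI z, ((sympForm pair zI z : ℝ) : EReal) ≤ b zI z
  extremal_right : ∀ zI z,
    b zI z = ((sympForm pair zI z : ℝ) : EReal) ↔ zI ∈ sympSubdiff pair (fun w => b zI w) z
  extremal_left : ∀ zI z,
    b zI z = ((sympForm pair zI z : ℝ) : EReal) ↔ -z ∈ sympSubdiff pair (fun w => b w z) zI

open Classical in
/-- The indicator function of `K`: `0` on `K` and `+∞` outside. -/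
def indicatorFn {V : Type*} (K : Set V) (v : V) : EReal := if v ∈ K then 0 else ⊤

/-- The Lebesgue integral of an extended-real-valued function: the integral of the positive
part minus that of the negative part. -/
def eIntegral {α : Type*} [MeasurableSpace α] (F : α → EReal) (μ : Measure α) : EReal :=
  ((∫⁻ a, (F a).toENNReal ∂μ : ℝ≥0∞) : EReal) - ((∫⁻ a, (-F a).toENNReal ∂μ : ℝ≥0∞) : EReal)

/-- The scalar product of `A × B` (whose Mathlib norm is not Euclidean). -/
def prodInner {A B : Type*} [NormedAddCommGroup A] [InnerProductSpace ℝ A]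
    [NormedAddCommGroup B] [InnerProductSpace ℝ B] (x x' : A × B) : ℝ :=
  inner ℝ x.1 x'.1 + inner ℝ x.2 x'.2

/-! ### Pointwise quantities -/

/-- Physical space `ℝ³`. -/
abbrev E3 := EuclideanSpace ℝ (Fin 3)

/-- The symmetric tensors, as a subspace of the `3 × 3` arrays; the induced scalar product is
the double contraction `a : b = ∑ i j, a i j * b i j`. -/
def symTensors : Submodule ℝ (EuclideanSpace ℝ (Fin 3 × Fin 3)) where
  carrier := {a | ∀ i j, a (i, j) = a (j, i)}
  add_mem' := by
    intro a b ha hb i j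
    simp [ha i j, hb i j]
  zero_mem' := by
    intro i j
    simp
  smul_mem' := by
    intro c a ha i j
    simp [ha i j]

/-- `S²(ℝ³)`. -/
abbrev Sym3 := ↥symTensors

/-- The symmetric gradient (small strain) of a displacement field, `(∂ᵢ φⱼ + ∂ⱼ φᵢ) / 2`. -/
def symGrad (φ : E3 → E3) (x : E3) : Sym3 :=
  ⟨WithLp.toLp 2 fun k : Fin 3 × Fin 3 =>
      ((fderiv ℝ φ x (EuclideanSpace.single k.1 1)) k.2 +
        (fderiv ℝ φ x (EuclideanSpace.single k.2 1)) k.1) / 2, by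
    intro i j
    simp [add_comm]⟩

/-- Pointwise values `(u, εᵖ)` (and `(p, π)`): the space `X = Y = ℝ³ × S²(ℝ³)`. -/
abbrev XPt := E3 × Sym3

/-- Pointwise phase space `Z = X × Y`, with elements `((u, εᵖ), (p, π))`. -/
abbrev ZPt := XPt × XPt

/-- The scalar product `⟪⟨(x, y), (x', y')⟩⟫ = ⟨x, x'⟩ + ⟨y, y'⟩` of `Z`. -/
def pairZ (z z' : ZPt) : ℝ := prodInner z.1 z'.1 + prodInner z.2 z'.2

/-- The inverse of `J (x, y) = (y, -x)`. -/
def Jinv (z : ZPt) : ZPt := (-z.2, z.1)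

/-- `b(z', z) = b_p(π', π) + I_{0}(u') + I_{0}(εᵖ') + I_{0}(p')`. -/
def bZ (bp : Sym3 → Sym3 → EReal) (z' z : ZPt) : EReal :=
  bp z'.2.2 z.2.2 + indicatorFn {0} z'.1.1 + indicatorFn {0} z'.1.2 + indicatorFn {0} z'.2.1

/-- `b̂(z_I, z) = b(J⁻¹ z_I, z)`. -/
def bHat (bp : Sym3 → Sym3 → EReal) (zI z : ZPt) : EReal := bZ bp (Jinv zI) z

/-! ### Function spaces -/

/-- `L²(Ω; ℝ³)`. -/
abbrev VecField (Ω : Set E3) := Lp E3 2 ((volume : Measure E3).restrict Ω)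

/-- `L²(Ω; S²(ℝ³))`. -/
abbrev TensField (Ω : Set E3) := Lp Sym3 2 ((volume : Measure E3).restrict Ω)

/-- `L²(Γ; ℝ³)` for the area measure on a surface `Γ`. -/
abbrev SurfField (Γ : Set E3) := Lp E3 2 ((Measure.euclideanHausdorffMeasure 2 : Measure E3).restrict Γ)

/-- Fields `(u, εᵖ)`, and `(p, π)`. -/
abbrev XField (Ω : Set E3) := VecField Ω × TensField Ω

/-- Fields `((u, εᵖ), (p, π))` of square integrable functions. -/
abbrev ZField (Ω : Set E3) := XField Ω × XField Ω

/-- Triples of a displacement field, its strain and its boundary values. -/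
abbrev DispTriple (Ω : Set E3) := VecField Ω × TensField Ω × SurfField (frontier Ω)

/-- The Sobolev space of displacement fields, each recorded with its strain `∇u` (symmetric part)
and its trace on the boundary: the limits of `(φ, ∇φ, φ|∂Ω)` with `φ` smooth. -/
def dispSpace (Ω : Set E3) : Set (DispTriple Ω) :=
  closure {w | ∃ φ : E3 → E3, ContDiff ℝ ∞ φ ∧
    (∀ᵐ x ∂((volume : Measure E3).restrict Ω), w.1 x = φ x) ∧
    (∀ᵐ x ∂((volume : Measure E3).restrict Ω), w.2.1 x = symGrad φ x) ∧
    (∀ᵐ x ∂((Measure.euclideanHausdorffMeasure 2 : Measure E3).restrict (frontier Ω)),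
      w.2.2 x = φ x)}

/-- States `((u, εᵖ), (p, π))` for which the Hamiltonian is defined: `u` comes with its strain
and its trace. -/
abbrev ZState (Ω : Set E3) := (DispTriple Ω × TensField Ω) × (VecField Ω × TensField Ω)

/-- The field `((u, εᵖ), (p, π))` underlying a state. -/
def toField {Ω : Set E3} (z : ZState Ω) : ZField Ω := ((z.1.1.1, z.1.2), z.2)

/-- The value of a phase field at a point. -/
def evalAt {Ω : Set E3} (z : ZField Ω) (x : E3) : ZPt := ((z.1.1 x, z.1.2 x), (z.2.1 x, z.2.2 x))

/-- Paths of class `H¹(0, T; W)`. -/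
structure IsH1Path {W : Type*} [NormedAddCommGroup W] [NormedSpace ℝ W] (T : ℝ) (w : ℝ → W) :
    Prop where
  differentiable : ∀ᵐ t ∂((volume : Measure ℝ).restrict (Icc 0 T)), DifferentiableAt ℝ w t
  memLp : MemLp (deriv w) 2 ((volume : Measure ℝ).restrict (Icc 0 T))
  eq_integral : ∀ t ∈ Icc 0 T, w t = w 0 + ∫ s in (0 : ℝ)..t, deriv w s

/-- `Ω` lies locally on one side of its boundary, and the boundary is a finite union of smoothly
embedded compact pieces without common interior points. -/
def HasPiecewiseSmoothBoundary (Ω : Set E3) : Prop :=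
  interior (closure Ω) = Ω ∧
  ∃ (n : ℕ) (K : Fin n → Set (EuclideanSpace ℝ (Fin 2))) (φ : Fin n → EuclideanSpace ℝ (Fin 2) → E3),
    (∀ i, IsCompact (K i) ∧ Convex ℝ (K i) ∧ (interior (K i)).Nonempty ∧
      ContDiff ℝ ∞ (φ i) ∧ InjOn (φ i) (K i) ∧
      ∀ s ∈ K i, Function.Injective (fderiv ℝ (φ i) s)) ∧
    (∀ i j, i ≠ j → Disjoint (φ i '' interior (K i)) (φ j '' interior (K j))) ∧
    frontier Ω = ⋃ i, φ i '' K i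

/-! ### The body -/

/-- Geometry, elasticity, density, loads, and initial and boundary data. -/
structure Body where
  /-- the domain -/
  Ω : Set E3
  isOpen_Ω : IsOpen Ω
  bounded_Ω : Bornology.IsBounded Ω
  smooth_Ω : HasPiecewiseSmoothBoundary Ω
  /-- the support, where displacements are imposed -/
  Γ₀ : Set E3
  /-- the part of the boundary where surface forces are imposed -/
  Γ₁ : Set E3
  measurable_Γ₀ : MeasurableSet Γ₀
  measurable_Γ₁ : MeasurableSet Γ₁
  disjoint_Γ : Disjoint Γ₀ Γ₁
  union_Γ : Γ₀ ∪ Γ₁ = frontier Ω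
  /-- the final time -/
  T : ℝ
  T_pos : 0 < T
  /-- the mass density -/
  ρ : ℝ
  ρ_pos : 0 < ρ
  /-- the elastic compliance -/
  S : Sym3 ≃L[ℝ] Sym3
  S_symm : ∀ a b, inner ℝ (S a) b = inner ℝ a (S b)
  S_pos : ∀ a, a ≠ 0 → 0 < inner ℝ a (S a)
  /-- volume forces -/
  f : ℝ → VecField Ω
  /-- surface forces -/
  fbar : ℝ → SurfField Γ₁
  /-- imposed displacements -/
  ubar : ℝ → SurfField Γ₀
  /-- the initial state -/
  z₀ : ZState Ω

namespace Body

variable (B : Body)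

/-- Lebesgue measure on the time interval. -/
def time : Measure ℝ := (volume : Measure ℝ).restrict (Icc 0 B.T)

/-- Lebesgue measure on the domain. -/
def space : Measure E3 := (volume : Measure E3).restrict B.Ω

/-- The compliance acting on tensor fields. -/
def compliance (s : TensField B.Ω) : TensField B.Ω := (B.S : Sym3 →L[ℝ] Sym3).compLp s

/-- The elasticity law `σ = S⁻¹ : (∇u - εᵖ)`. -/
def stress (z : ZState B.Ω) : TensField B.Ω :=
  (B.S.symm : Sym3 →L[ℝ] Sym3).compLp (z.1.1.2.1 - z.1.2)

/-- The elastic strain energy `w(ε) = ε : S⁻¹ ε / 2`. -/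
def energy (e : Sym3) : ℝ := (1 / 2) * inner ℝ e (B.S.symm e)

/-- The Hamiltonian `H(t, z)` of the structure. -/
def hamiltonian (t : ℝ) (z : ZState B.Ω) : ℝ :=
  (∫ x, (1 / (2 * B.ρ) * ‖z.2.1 x‖ ^ 2 + B.energy (z.1.1.2.1 x - z.1.2 x)
      - inner ℝ (B.f t x) (z.1.1.1 x)) ∂B.space)
    - ∫ x, inner ℝ (B.fbar t x) (z.1.1.2.2 x)
        ∂((Measure.euclideanHausdorffMeasure 2 : Measure E3).restrict B.Γ₁)

/-- The virtual displacements: those which vanish on the support. -/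
def virtualDisp : Set (DispTriple B.Ω) :=
  {v | v ∈ dispSpace B.Ω ∧
    ∀ᵐ x ∂((Measure.euclideanHausdorffMeasure 2 : Measure E3).restrict B.Γ₀), v.2.2 x = 0}

/-- `X` is the symplectic gradient of the Hamiltonian at `z`: `ω(X, ζ)` is the derivative of
`H(t, ·)` at `z` in every direction `ζ` whose displacement part is virtual. -/
def IsSymplecticGradient (t : ℝ) (z : ZState B.Ω) (X : ZField B.Ω) : Prop :=
  ∀ ζ : ZState B.Ω, ζ.1.1 ∈ B.virtualDisp →
    Tendsto (fun ε : ℝ => (1 / ε) * (B.hamiltonian t (z + ε • ζ) - B.hamiltonian t z))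
      (𝓝[≠] 0) (𝓝 (sympForm prodInner X (toField ζ)))

/-- Weak form of `∇·σ = d` in `Ω` together with `σ·n = f̄(t)` on `Γ₁`. -/
def IsDivergence (t : ℝ) (s : TensField B.Ω) (d : VecField B.Ω) : Prop :=
  ∀ v ∈ B.virtualDisp, inner ℝ s v.2.1 + inner ℝ d v.1 =
    ∫ x, inner ℝ (B.fbar t x) (v.2.2 x)
      ∂((Measure.euclideanHausdorffMeasure 2 : Measure E3).restrict B.Γ₁)

/-- Displacement paths of class `H¹` in time which take the imposed values on `Γ₀`. -/
structure IsDispPath (u : ℝ → DispTriple B.Ω) : Prop where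
  h1 : IsH1Path B.T u
  mem : ∀ t ∈ Icc 0 B.T, u t ∈ dispSpace B.Ω
  support : ∀ t ∈ Icc 0 B.T,
    ∀ᵐ x ∂((Measure.euclideanHausdorffMeasure 2 : Measure E3).restrict B.Γ₀),
      (u t).2.2 x = B.ubar t x

/-! ### Paths in phase space -/

/-- `z` is an admissible path in phase space, along which `X` is the symplectic gradient. -/
structure IsPhasePath (z : ℝ → ZState B.Ω) (X : ℝ → ZField B.Ω) : Prop where
  h1 : IsH1Path B.T z
  disp : B.IsDispPath (fun t => (z t).1.1)
  initial : z 0 = B.z₀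
  gradient : ∀ᵐ t ∂B.time, B.IsSymplecticGradient t (z t) (X t)
  gradient_memLp : MemLp X 2 B.time

/-- The velocity `ż` as a field. -/
def rate (z : ℝ → ZState B.Ω) (t : ℝ) : ZField B.Ω := toField (deriv z t)

/-- The irreversible part `ż_I = ż - X_H` of the velocity. -/
def irrev (z : ℝ → ZState B.Ω) (X : ℝ → ZField B.Ω) (t : ℝ) : ZField B.Ω := B.rate z t - X t

/-- `B̂(z_I, z) = ∫_Ω b̂(z_I, z) dΩ`. -/
def phaseBHat (bp : Sym3 → Sym3 → EReal) (zI z : ZField B.Ω) : EReal :=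
  eIntegral (fun x => bHat bp (evalAt zI x) (evalAt z x)) B.space

/-- `Π(z) = ∫₀ᵀ {B̂(ż - X_H, ż) - ω(ż - X_H, ż)} dt`. -/
def phaseFunctional (bp : Sym3 → Sym3 → EReal) (z : ℝ → ZState B.Ω) (X : ℝ → ZField B.Ω) :
    EReal :=
  eIntegral (fun t => B.phaseBHat bp (B.irrev z X t) (B.rate z t)
    - ((sympForm prodInner (B.irrev z X t) (B.rate z t) : ℝ) : EReal)) B.time

/-- The Hamiltonian inclusion `ż_I ∈ ∂^ω b̂(ż_I, •)(ż)`, almost everywhere in `[0, T] × Ω`. -/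
def HamiltonianInclusion (bp : Sym3 → Sym3 → EReal) (z : ℝ → ZState B.Ω) (X : ℝ → ZField B.Ω) :
    Prop :=
  ∀ᵐ t ∂B.time, ∀ᵐ x ∂B.space,
    evalAt (B.irrev z X t) x ∈
      sympSubdiff prodInner (fun w => bHat bp (evalAt (B.irrev z X t) x) w) (evalAt (B.rate z t) x)

/-- The constraints `p = ρ u̇`, `∇·σ + f = ṗ`, `π̇ = σ`. -/
def Constraints (z : ℝ → ZState B.Ω) : Prop :=
  ∀ᵐ t ∂B.time, (z t).2.1 = B.ρ • (B.rate z t).1.1 ∧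
    (∃ d, B.IsDivergence t (B.stress (z t)) d ∧ d + B.f t = (B.rate z t).2.1) ∧
    (B.rate z t).2.2 = B.stress (z t)

/-! ### Paths of displacements and stresses -/

/-- Admissible paths `(u, σ)`: they satisfy the boundary conditions, the initial conditions on
`u`, on `σ` (through the plastic strain) and on `u̇`, and the dynamic equilibrium
`∇·σ + f = ρ ü`. Here `v` is the continuous representative of `u̇`. -/
structure IsAdmissible (u : ℝ → DispTriple B.Ω) (σ : ℝ → TensField B.Ω) : Prop where
  disp : B.IsDispPath u
  h1 : IsH1Path B.T σ
  initial_disp : u 0 = B.z₀.1.1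
  initial_stress : σ 0 = B.stress B.z₀
  equilibrium : ∃ v : ℝ → VecField B.Ω, IsH1Path B.T v ∧
    (∀ᵐ t ∂B.time, (deriv u t).1 = v t) ∧ B.ρ • v 0 = B.z₀.2.1 ∧
    ∀ᵐ t ∂B.time, ∃ d, B.IsDivergence t (σ t) d ∧ d + B.f t = B.ρ • deriv v t

/-- The plastic strain rate `∇u̇ - S : σ̇`. -/
def plasticRate (u : ℝ → DispTriple B.Ω) (σ : ℝ → TensField B.Ω) (t : ℝ) : TensField B.Ω :=
  (deriv u t).2.1 - B.compliance (deriv σ t)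

/-- `B̂(e, s) = ∫_Ω b_p(e, s) dΩ`. -/
def reducedBHat (bp : Sym3 → Sym3 → EReal) (e s : TensField B.Ω) : EReal :=
  eIntegral (fun x => bp (e x) (s x)) B.space

/-- `Π(u, σ) = ∫₀ᵀ {B̂(∇u̇ - S : σ̇, σ) - ⟨∇u̇ - S : σ̇, σ⟩} dt`. -/
def functional (bp : Sym3 → Sym3 → EReal) (u : ℝ → DispTriple B.Ω) (σ : ℝ → TensField B.Ω) :
    EReal :=
  eIntegral (fun t => B.reducedBHat bp (B.plasticRate u σ t) (σ t)
    - ((inner ℝ (B.plasticRate u σ t) (σ t) : ℝ) : EReal)) B.time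

/-- The natural evolutions: displacements and stresses of the admissible paths in phase space
which obey the Hamiltonian inclusion. -/
def IsNaturalEvolution (bp : Sym3 → Sym3 → EReal) (u : ℝ → DispTriple B.Ω)
    (σ : ℝ → TensField B.Ω) : Prop :=
  ∃ z X, B.IsPhasePath z X ∧ B.HamiltonianInclusion bp z X ∧
    (∀ t, u t = (z t).1.1) ∧ ∀ t, σ t = B.stress (z t)

/-- The flow rule `ε̇ᵖ ∈ ∂b_p(ε̇ᵖ, •)(σ)` with `ε̇ᵖ = ∇u̇ - S : σ̇`, almost everywhere in
`[0, T] × Ω`. -/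
def FlowRule (bp : Sym3 → Sym3 → EReal) (u : ℝ → DispTriple B.Ω) (σ : ℝ → TensField B.Ω) :
    Prop :=
  ∀ᵐ t ∂B.time, ∀ᵐ x ∂B.space,
    B.plasticRate u σ t x ∈
      subdiff (fun h d => inner ℝ d h) (fun s => bp (B.plasticRate u σ t x) s) (σ t x)

end Body

end SBEN

end

namespace SBEN

/-! ### The bipotentials assembled from `bp` -/

section Pairings

variable {A A' : Type*} [NormedAddCommGroup A] [InnerProductSpace ℝ A]
  [NormedAddCommGroup A'] [InnerProductSpace ℝ A']

/-! The functional integrates a Fenchel gap. Since `b̂ ≥ ω` pointwise, the gap is nonnegative, and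
by the defining property of bipotentials it vanishes exactly where the inclusion holds. A
nonnegative integral is zero iff its integrand is zero almost everywhere; this gives nonnegativity,
the equality case and the minimum principle.

Pointwise, `J⁻¹` carries `ω` to the scalar product, so `b̂` inherits its properties from `b`.
Finiteness of `b` forces three components to vanish and leaves `b_p` in the fourth, whose
extremality is tested by varying that slot alone.

The reduction rests on computing `X_H`. The Hamiltonian is a quadratic form plus a linear one, and
comparing it with `ω` slot by slot gives `X_H = ((p/ρ, 0), (∇·σ + f, σ))`, the third component in
the weak sense (`isSymplecticGradient_iff`). The irreversible rate is therefore `((u̇ - p/ρ, ε̇ᵖ),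
(ṗ - f - ∇·σ, π̇ - σ))`, and the constraints say that everything except `ε̇ᵖ` vanishes
(`constraints_iff`, which needs uniqueness of the weak divergence). Under them the gap becomes
`b_p(ε̇ᵖ, σ) - ε̇ᵖ : σ` with `ε̇ᵖ = ∇u̇ - S : σ̇`; if they fail on a non-null set of times, the
integral is `+∞`. Conversely `εᵖ = ∇u - S : σ`, `p = ρ u̇` and `π = π₀ + ∫ σ` lift an admissible
path to phase space.

Two analytic points remain. Subtracting under the integral is legitimate because the minorant is
integrable (`eIntegral_sub_integral`). Measurability in time of the spatial gap comes from the law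
of the field values, which depends measurably on the fields in `L²` (`aemeasurable_lintegral_comp`).
-/

lemma prodInner_add_left (x y w : A × A') : prodInner (x + y) w = prodInner x w + prodInner y w := by
  simp only [prodInner, Prod.fst_add, Prod.snd_add, inner_add_left]; ring

lemma prodInner_add_right (x y w : A × A') : prodInner w (x + y) = prodInner w x + prodInner w y := by
  simp only [prodInner, Prod.fst_add, Prod.snd_add, inner_add_right]; ring

lemma prodInner_neg_left (x w : A × A') : prodInner (-x) w = -prodInner x w := by
  simp only [prodInner, Prod.fst_neg, Prod.snd_neg, inner_neg_left]; ring

lemma prodInner_comm (x w : A × A') : prodInner x w = prodInner w x := by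
  simp only [prodInner, real_inner_comm]

end Pairings

lemma pairZ_add_left (x y w : ZPt) : pairZ (x + y) w = pairZ x w + pairZ y w := by
  simp only [pairZ, Prod.fst_add, Prod.snd_add, prodInner_add_left]; ring

lemma pairZ_add_right (x y w : ZPt) : pairZ w (x + y) = pairZ w x + pairZ w y := by
  simp only [pairZ, Prod.fst_add, Prod.snd_add, prodInner_add_right]; ring

lemma sympForm_eq_pairZ (zI z : ZPt) : sympForm prodInner zI z = pairZ (Jinv zI) z := by
  simp only [sympForm, pairZ, Jinv, prodInner_neg_left, prodInner_comm z.1]; ring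

lemma sympForm_neg_left (z w : ZPt) : sympForm prodInner (-z) w = sympForm prodInner w z := by
  simp only [sympForm, Prod.fst_neg, Prod.snd_neg, prodInner_neg_left,
    prodInner_comm w.1 (-z.2), prodInner_comm w.1 z.2]
  ring

/-- Where a function touches a minorant that is affine in the direction `h`, its slope is a
subgradient. -/
lemma mem_subdiff_of_touch {V D : Type*} [AddCommGroup V] {p : V → D → ℝ} {F : V → EReal}
    {v : V} {d : D} {m : V → ℝ} (hm : ∀ h, m (v + h) = m v + p h d)
    (hle : ∀ w, (m w : EReal) ≤ F w) (hv : F v = m v) : d ∈ subdiff p F v := by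
  refine ⟨by simp [hv], by simp [hv], fun h => ?_⟩
  rw [hv, ← EReal.coe_add, ← hm]
  exact hle _

lemma continuous_Jinv : Continuous Jinv := by
  unfold Jinv; fun_prop

lemma Jinv_add (z w : ZPt) : Jinv (z + w) = Jinv z + Jinv w := by
  simp only [Jinv, Prod.fst_add, Prod.snd_add, neg_add, Prod.mk_add_mk]

section Assembled

variable {bp : Sym3 → Sym3 → EReal}
  (hbp : IsBipotential (fun e s : Sym3 => (inner ℝ e s : ℝ)) bp)
include hbp

lemma bp_ne_bot (e s : Sym3) : bp e s ≠ ⊥ := fun h => by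
  have := hbp.fenchel e s
  simp [h] at this

-- In `EReal`, `⊥ + ⊤ = ⊥`: the indicators act as constraints only because Fenchel's inequality
-- keeps `bp` away from `-∞`.
open Classical in
lemma bZ_eq (z' z : ZPt) : bZ bp z' z =
    if z'.1.1 = 0 ∧ z'.1.2 = 0 ∧ z'.2.1 = 0 then bp z'.2.2 z.2.2 else ⊤ := by
  have h := bp_ne_bot hbp z'.2.2 z.2.2
  simp only [bZ, indicatorFn, mem_singleton_iff]
  by_cases h1 : z'.1.1 = 0 <;> by_cases h2 : z'.1.2 = 0 <;> by_cases h3 : z'.2.1 = 0 <;>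
    simp [h1, h2, h3, h]

lemma bZ_le_iff (z' z : ZPt) (c : EReal) : bZ bp z' z ≤ c ↔
    c = ⊤ ∨ (z'.1.1 = 0 ∧ z'.1.2 = 0 ∧ z'.2.1 = 0) ∧ bp z'.2.2 z.2.2 ≤ c := by
  rw [bZ_eq hbp]
  split_ifs with h
  · simp only [h, and_self, true_and]
    exact ⟨Or.inr, fun h => h.elim (fun h => h ▸ le_top) id⟩
  · simp [h]

lemma bZ_ne_top {z' z : ZPt} (h : bZ bp z' z ≠ ⊤) :
    z'.1.1 = 0 ∧ z'.1.2 = 0 ∧ z'.2.1 = 0 := by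
  rw [bZ_eq hbp] at h
  by_contra h'
  simp [h'] at h

lemma pairZ_le_bZ (z' z : ZPt) : (pairZ z' z : EReal) ≤ bZ bp z' z := by
  rw [bZ_eq hbp]
  split_ifs with h
  · simpa [pairZ, prodInner, h.1, h.2.1, h.2.2] using hbp.fenchel z'.2.2 z.2.2
  · exact le_top

lemma bZ_eq_pairZ_iff (z' z : ZPt) : bZ bp z' z = (pairZ z' z : EReal) ↔
    (z'.1.1 = 0 ∧ z'.1.2 = 0 ∧ z'.2.1 = 0) ∧
      bp z'.2.2 z.2.2 = ((inner ℝ z'.2.2 z.2.2 : ℝ) : EReal) := by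
  rw [bZ_eq hbp]
  split_ifs with h
  · simp [pairZ, prodInner, h.1, h.2.1, h.2.2]
  · simp [h]

/-- Epigraphs and sublevel sets are those of `bp` cut by linear constraints, hence convex and
closed. For extremality, touching the bilinear minorant yields a subgradient; conversely a
subgradient presupposes a finite value, so the constrained components vanish and `bp` is left. -/
lemma isBipotential_bZ : IsBipotential pairZ (bZ bp) where
  convex_left z := by
    intro x hx y hy a b ha hb hab
    simp only [mem_ofPred_eq, bZ_le_iff hbp, EReal.coe_ne_top, false_or] at hx hy ⊢
    refine ⟨?_, ?_⟩
    · simp [hx.1.1, hx.1.2.1, hx.1.2.2, hy.1.1, hy.1.2.1, hy.1.2.2]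
    · exact hbp.convex_left z.2.2 (show (x.1.2.2, x.2) ∈ _ from hx.2)
        (show (y.1.2.2, y.2) ∈ _ from hy.2) ha hb hab
  convex_right z' := by
    intro x hx y hy a b ha hb hab
    simp only [mem_ofPred_eq, bZ_le_iff hbp, EReal.coe_ne_top, false_or] at hx hy ⊢
    refine ⟨hx.1, ?_⟩
    exact hbp.convex_right z'.2.2 (show (x.1.2.2, x.2) ∈ _ from hx.2)
        (show (y.1.2.2, y.2) ∈ _ from hy.2) ha hb hab
  lsc_left z := by
    rw [lowerSemicontinuous_iff_isClosed_preimage]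
    intro c
    have h := lowerSemicontinuous_iff_isClosed_preimage.1 (hbp.lsc_left z.2.2) c
    have : (fun x => bZ bp x z) ⁻¹' Iic c = {_x : ZPt | c = ⊤} ∪
        ({x : ZPt | x.1.1 = 0} ∩ ({x | x.1.2 = 0} ∩ {x | x.2.1 = 0}) ∩
          (fun x : ZPt => x.2.2) ⁻¹' ((fun e => bp e z.2.2) ⁻¹' Iic c)) := by
      ext x
      simp [bZ_le_iff hbp]
    rw [this]
    refine isClosed_const.union (IsClosed.inter ?_ (h.preimage (by fun_prop)))
    exact (isClosed_eq (by fun_prop) (by fun_prop)).inter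
      ((isClosed_eq (by fun_prop) (by fun_prop)).inter (isClosed_eq (by fun_prop) (by fun_prop)))
  lsc_right z' := by
    rw [lowerSemicontinuous_iff_isClosed_preimage]
    intro c
    have h := lowerSemicontinuous_iff_isClosed_preimage.1 (hbp.lsc_right z'.2.2) c
    have : (fun x => bZ bp z' x) ⁻¹' Iic c = {_x : ZPt | c = ⊤} ∪
        ({_x : ZPt | z'.1.1 = 0 ∧ z'.1.2 = 0 ∧ z'.2.1 = 0} ∩
          (fun x : ZPt => x.2.2) ⁻¹' ((fun e => bp z'.2.2 e) ⁻¹' Iic c)) := by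
      ext x
      simp [bZ_le_iff hbp]
    rw [this]
    exact isClosed_const.union (isClosed_const.inter (h.preimage (by fun_prop)))
  fenchel := pairZ_le_bZ hbp
  extremal_left z' z := by
    refine ⟨mem_subdiff_of_touch (m := fun w => pairZ w z)
      (fun h => pairZ_add_left _ _ _) (fun w => pairZ_le_bZ hbp w z), fun h => ?_⟩
    have h0 := bZ_ne_top hbp h.1
    rw [bZ_eq_pairZ_iff hbp]
    refine ⟨h0, (hbp.extremal_left _ _).2 ⟨?_, bp_ne_bot hbp _ _, fun k => ?_⟩⟩
    · simpa [bZ_eq hbp, h0] using h.1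
    -- Varying only the unconstrained slot turns the subgradient inequality for `bZ` into that for
    -- `bp`.
    · simpa [bZ_eq hbp, h0, pairZ, prodInner] using h.2.2 ((0, 0), (0, k))
  extremal_right z' z := by
    refine ⟨mem_subdiff_of_touch (m := fun w => pairZ z' w)
      (fun h => pairZ_add_right _ _ _) (fun w => pairZ_le_bZ hbp z' w), fun h => ?_⟩
    have h0 := bZ_ne_top hbp h.1
    rw [bZ_eq_pairZ_iff hbp]
    refine ⟨h0, (hbp.extremal_right _ _).2 ⟨?_, bp_ne_bot hbp _ _, fun k => ?_⟩⟩
    · simpa [bZ_eq hbp, h0] using h.1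
    · simpa [bZ_eq hbp, h0, pairZ, prodInner] using h.2.2 ((0, 0), (0, k))

lemma isSymplecticBipotential_bHat :
    IsSymplecticBipotential (prodInner : XPt → XPt → ℝ) (bHat bp) where
  convex_left z := by
    intro x hx y hy a b ha hb hab
    have := (isBipotential_bZ hbp).convex_left z (show (Jinv x.1, x.2) ∈ _ from hx)
      (show (Jinv y.1, y.2) ∈ _ from hy) ha hb hab
    have e : Jinv (a • x.1 + b • y.1) = a • Jinv x.1 + b • Jinv y.1 := by
      simp [Jinv, add_comm]
    simpa [bHat, e] using this
  convex_right zI := (isBipotential_bZ hbp).convex_right (Jinv zI)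
  lsc_left z := fun x c hc =>
    continuous_Jinv.continuousAt.eventually ((isBipotential_bZ hbp).lsc_left z (Jinv x) c hc)
  lsc_right zI := (isBipotential_bZ hbp).lsc_right (Jinv zI)
  fenchel zI z := by
    rw [sympForm_eq_pairZ]
    exact pairZ_le_bZ hbp _ _
  extremal_right zI z := by
    rw [sympForm_eq_pairZ]
    refine ((isBipotential_bZ hbp).extremal_right (Jinv zI) z).trans ?_
    simp only [sympSubdiff, subdiff, sympForm_eq_pairZ, mem_ofPred_eq]
    rfl
  extremal_left zI z := by
    rw [sympForm_eq_pairZ]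
    refine ((isBipotential_bZ hbp).extremal_left (Jinv zI) z).trans ?_
    -- Antisymmetry of `ω` accounts for the sign of `-z` in the left extremality condition.
    have e : ∀ w, sympForm prodInner (-z) w = pairZ (Jinv w) z := fun w => by
      rw [sympForm_neg_left, sympForm_eq_pairZ]
    simp only [sympSubdiff, subdiff, mem_ofPred_eq, e, bHat, Jinv_add]
    refine and_congr_right fun _ => and_congr_right fun _ => ⟨fun H h => H _, fun H h => ?_⟩
    -- `(h.2, -h.1)` is `J h`: each variation of `J⁻¹ zI` is the image of a variation of `zI`.
    have e' : Jinv (h.2, -h.1) = h := by simp [Jinv]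
    simpa only [e'] using H (h.2, -h.1)

/-- The Hamiltonian inclusion at a point: all components of the irreversible rate vanish except
the plastic strain rate, which obeys the flow rule. -/
lemma mem_sympSubdiff_bHat_iff (zI z : ZPt) :
    zI ∈ sympSubdiff prodInner (fun w => bHat bp zI w) z ↔
      (zI.1.1 = 0 ∧ zI.2.1 = 0 ∧ zI.2.2 = 0) ∧
        bp zI.1.2 z.2.2 = ((inner ℝ zI.1.2 z.2.2 : ℝ) : EReal) := by
  rw [← (isSymplecticBipotential_bHat hbp).extremal_right, sympForm_eq_pairZ, bHat,
    bZ_eq_pairZ_iff hbp]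
  simp only [Jinv, Prod.fst_neg, Prod.snd_neg, neg_eq_zero]
  tauto

end Assembled

/-! ### Integrals of extended-real-valued functions -/

section Integrals

variable {α : Type*} [MeasurableSpace α] {μ : Measure α}

lemma eIntegral_congr_ae {F G : α → EReal} (h : F =ᵐ[μ] G) : eIntegral F μ = eIntegral G μ := by
  unfold eIntegral
  rw [lintegral_congr_ae (h.mono fun a ha => by rw [ha]),
    lintegral_congr_ae (h.mono fun a ha => show (-F a).toENNReal = (-G a).toENNReal by rw [ha])]

lemma eIntegral_coe_ennreal (F : α → ℝ≥0∞) :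
    eIntegral (fun a => (F a : EReal)) μ = ((∫⁻ a, F a ∂μ : ℝ≥0∞) : EReal) := by
  have : ∀ a, (-(F a : EReal)).toENNReal = 0 := fun a =>
    EReal.toENNReal_of_nonpos (by simpa using EReal.coe_ennreal_nonneg (F a))
  simp only [eIntegral, this, EReal.toENNReal_coe, lintegral_zero, EReal.coe_ennreal_zero, sub_zero]

/-- This is `F - g = F⁺ - F⁻ - g⁺ + g⁻` with the negative terms moved across, so that no infinities
are subtracted. -/
lemma toENNReal_split {F : EReal} {g : ℝ} (h : (g : EReal) ≤ F) :
    (F - g).toENNReal + ((-F).toENNReal + ENNReal.ofReal g) =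
      F.toENNReal + ENNReal.ofReal (-g) := by
  induction F using EReal.rec with
  | bot => simp at h
  | top => simp
  | coe r =>
    have h : g ≤ r := by exact_mod_cast h
    rw [← EReal.coe_sub, ← EReal.coe_neg]
    simp only [EReal.real_coe_toENNReal]
    rcases le_total 0 r with hr | hr <;> rcases le_total 0 g with hg | hg
    · rw [ENNReal.ofReal_of_nonpos (p := -r) (by linarith),
        ENNReal.ofReal_of_nonpos (p := -g) (by linarith), zero_add, add_zero,
        ← ENNReal.ofReal_add (by linarith) hg]
      ring_nf
    · rw [ENNReal.ofReal_of_nonpos (p := -r) (by linarith), ENNReal.ofReal_of_nonpos hg, zero_add,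
        add_zero, ← ENNReal.ofReal_add hr (by linarith)]
      ring_nf
    · have : r = 0 := by linarith
      have : g = 0 := by linarith
      simp [*]
    · rw [ENNReal.ofReal_of_nonpos hr, ENNReal.ofReal_of_nonpos hg, zero_add, add_zero,
        ← ENNReal.ofReal_add (by linarith) (by linarith)]
      ring_nf

/-- The integral of a function above an integrable one, less the integral of the latter, is the
integral of the nonnegative difference. -/
lemma eIntegral_sub_integral {F : α → EReal} {g : α → ℝ} (hF : AEMeasurable F μ)
    (hg : Integrable g μ) (h : ∀ a, (g a : EReal) ≤ F a) :
    eIntegral F μ - ((∫ a, g a ∂μ : ℝ) : EReal) =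
      ((∫⁻ a, (F a - g a).toENNReal ∂μ : ℝ≥0∞) : EReal) := by
  have hgp : AEMeasurable (fun a => ENNReal.ofReal (g a)) μ := hg.aemeasurable.ennreal_ofReal
  have hgn : AEMeasurable (fun a => ENNReal.ofReal (-g a)) μ := hg.neg.aemeasurable.ennreal_ofReal
  have hFn : AEMeasurable (fun a => (-F a).toENNReal) μ :=
    (continuous_neg.measurable.comp_aemeasurable hF).ereal_toENNReal
  have key := lintegral_congr (μ := μ) fun a => toENNReal_split (h a)
  rw [lintegral_add_right' _ (show AEMeasurable (fun a => (-F a).toENNReal +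
    ENNReal.ofReal (g a)) μ from hFn.add hgp), lintegral_add_right' _ hgp,
    lintegral_add_right' _ hgn] at key
  have fp : ∫⁻ a, ENNReal.ofReal (g a) ∂μ ≠ ⊤ := hg.lintegral_lt_top.ne
  have fn : ∫⁻ a, ENNReal.ofReal (-g a) ∂μ ≠ ⊤ := hg.neg.lintegral_lt_top.ne
  -- From `g ≤ F`, the negative part of `F` is at most that of `g`; only the positive part of `F`
  -- can have infinite integral.
  have fF : ∫⁻ a, (-F a).toENNReal ∂μ ≠ ⊤ := by
    refine ne_top_of_le_ne_top fn (lintegral_mono fun a => ?_)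
    simpa using EReal.toENNReal_le_toENNReal (EReal.neg_le_neg_iff.2 (h a))
  rw [integral_eq_lintegral_pos_part_sub_lintegral_neg_part hg, eIntegral]
  generalize (∫⁻ a, (F a - g a).toENNReal ∂μ) = D at key ⊢
  generalize (∫⁻ a, (-F a).toENNReal ∂μ) = Fn at key fF ⊢
  generalize (∫⁻ a, (F a).toENNReal ∂μ) = Fp at key ⊢
  generalize (∫⁻ a, ENNReal.ofReal (g a) ∂μ) = gp at key fp ⊢
  generalize (∫⁻ a, ENNReal.ofReal (-g a) ∂μ) = gn at key fn ⊢
  lift gp to NNReal using fp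
  lift gn to NNReal using fn
  lift Fn to NNReal using fF
  induction D using ENNReal.recTopCoe with
  | top =>
    have : Fp = ⊤ := by
      by_contra hne
      lift Fp to NNReal using hne
      simp [← ENNReal.coe_add] at key
    subst this
    have e : ((Fn : ℝ≥0∞) : EReal) = ((Fn : ℝ) : EReal) := rfl
    rw [EReal.coe_ennreal_top, e, EReal.top_sub_coe, EReal.top_sub_coe]
  | coe D =>
    have : Fp ≠ ⊤ := by
      rintro rfl
      simp [← ENNReal.coe_add] at key
    lift Fp to NNReal using this
    have key' : (D : ℝ) + (Fn + gp) = Fp + gn := by exact_mod_cast key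
    change ((Fp : ℝ) : EReal) - ((Fn : ℝ) : EReal) - (((gp : ℝ) - (gn : ℝ) : ℝ) : EReal) =
      ((D : ℝ) : EReal)
    rw [← EReal.coe_sub, ← EReal.coe_sub]
    congr 1
    linarith

/-- The integrable minorant keeps the negative part finite, while `⊤` on a non-null set makes the
positive part infinite. -/
lemma eIntegral_eq_top {F : α → EReal} {g : α → ℝ} (hg : Integrable g μ)
    (h : ∀ a, (g a : EReal) ≤ F a) {s : Set α} (hs : NullMeasurableSet s μ) (hs0 : μ s ≠ 0)
    (hF : ∀ a ∈ s, F a = ⊤) : eIntegral F μ = ⊤ := by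
  have fF : ∫⁻ a, (-F a).toENNReal ∂μ ≠ ⊤ := by
    refine ne_top_of_le_ne_top hg.neg.lintegral_lt_top.ne (lintegral_mono fun a => ?_)
    simpa using EReal.toENNReal_le_toENNReal (EReal.neg_le_neg_iff.2 (h a))
  have fp : ∫⁻ a, (F a).toENNReal ∂μ = ⊤ := by
    refine top_le_iff.1 (le_trans ?_ (setLIntegral_le_lintegral s _))
    have : ∫⁻ _ in s, (⊤ : ℝ≥0∞) ∂μ = ⊤ := by simp [ENNReal.top_mul hs0]
    rw [← this]
    refine lintegral_mono_ae ?_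
    rw [ae_restrict_iff'₀ hs]
    exact Eventually.of_forall fun a ha => by simp [hF a ha]
  rw [eIntegral, fp]
  lift (∫⁻ a, (-F a).toENNReal ∂μ) to NNReal using fF with r
  exact EReal.top_sub_coe r

end Integrals

/-! ### Measurability of Nemytskii functionals on `L²` -/

section Nemytskii

variable {α : Type*} [MeasurableSpace α] {μ : Measure α}
  {E F : Type*} [NormedAddCommGroup E] [MeasurableSpace E] [BorelSpace E]
  [NormedAddCommGroup F] [MeasurableSpace F] [BorelSpace F]

lemma aemeasurable_lp_pair (q : Lp E 2 μ × Lp F 2 μ) : AEMeasurable (fun x => (q.1 x, q.2 x)) μ :=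
  (Lp.aestronglyMeasurable q.1).aemeasurable.prodMk (Lp.aestronglyMeasurable q.2).aemeasurable

variable [SecondCountableTopology F]

/-- Convergence in `L²` gives convergence almost everywhere of both components along a subsequence.
The indicator of an open set is lower semicontinuous, and Fatou's lemma concludes. -/
lemma lowerSemicontinuous_measure_preimage {U : Set (E × F)} (hU : IsOpen U) :
    LowerSemicontinuous fun q : Lp E 2 μ × Lp F 2 μ => μ.map (fun x => (q.1 x, q.2 x)) U := by
  rw [lowerSemicontinuous_iff_isClosed_preimage]
  intro c
  refine IsSeqClosed.isClosed fun q q₀ hq hlim => ?_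
  simp only [mem_preimage, mem_Iic,
    Measure.map_apply_of_aemeasurable (aemeasurable_lp_pair _) hU.measurableSet] at hq ⊢
  obtain ⟨φ, hφ, h1⟩ := (tendstoInMeasure_of_tendsto_Lp
    ((continuous_fst.tendsto _).comp hlim)).exists_seq_tendsto_ae
  obtain ⟨ψ, hψ, h2⟩ := (tendstoInMeasure_of_tendsto_Lp
    (((continuous_snd.tendsto _).comp hlim).comp hφ.tendsto_atTop)).exists_seq_tendsto_ae
  have hmeas : ∀ p : Lp E 2 μ × Lp F 2 μ,
      NullMeasurableSet ((fun x => (p.1 x, p.2 x)) ⁻¹' U) μ := fun p =>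
    (aemeasurable_lp_pair p).nullMeasurableSet_preimage hU.measurableSet
  calc μ ((fun x => (q₀.1 x, q₀.2 x)) ⁻¹' U)
      = ∫⁻ x, ((fun x => (q₀.1 x, q₀.2 x)) ⁻¹' U).indicator 1 x ∂μ :=
        (lintegral_indicator_one₀ (hmeas q₀)).symm
    _ ≤ ∫⁻ x, liminf (fun n =>
          ((fun x => ((q (φ (ψ n))).1 x, (q (φ (ψ n))).2 x)) ⁻¹' U).indicator 1 x) atTop ∂μ := by
        refine lintegral_mono_ae ?_
        filter_upwards [h1, h2] with x hx1 hx2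
        by_cases hx : (q₀.1 x, q₀.2 x) ∈ U
        · have ht : Tendsto (fun n => ((q (φ (ψ n))).1 x, (q (φ (ψ n))).2 x)) atTop
              (𝓝 (q₀.1 x, q₀.2 x)) :=
            Tendsto.prodMk_nhds (hx1.comp hψ.tendsto_atTop) hx2
          rw [indicator_of_mem (by exact hx)]
          refine le_liminf_of_le (by isBoundedDefault) ?_
          filter_upwards [ht.eventually (hU.mem_nhds hx)] with n hn
          rw [indicator_of_mem (by exact hn)]
        · rw [indicator_of_notMem (by exact hx)]
          exact zero_le
    _ ≤ liminf (fun n => ∫⁻ x,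
          ((fun x => ((q (φ (ψ n))).1 x, (q (φ (ψ n))).2 x)) ⁻¹' U).indicator 1 x ∂μ) atTop :=
        lintegral_liminf_le' fun n => aemeasurable_one.indicator₀ (hmeas _)
    _ ≤ c := by
        refine liminf_le_of_frequently_le' (Frequently.of_forall fun n => ?_)
        rw [lintegral_indicator_one₀ (hmeas _)]
        exact hq _

/-- Along measurable paths in `L²`, integrals of Borel functions of the values are measurable. -/
lemma aemeasurable_lintegral_comp [IsFiniteMeasure μ] {τ : Type*} [MeasurableSpace τ]
    {ν : Measure τ} {e : τ → Lp E 2 μ} {s : τ → Lp F 2 μ} (he : AEStronglyMeasurable e ν)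
    (hs : AEStronglyMeasurable s ν) {h : E × F → ℝ≥0∞} (hh : Measurable h) :
    AEMeasurable (fun t => ∫⁻ x, h (e t x, s t x) ∂μ) ν := by
  borelize (Lp E 2 μ × Lp F 2 μ)
  -- Open sets form a π-system generating the Borel sets, and their mass is lower semicontinuous in
  -- `q`. Working with the law avoids choosing a jointly measurable representative of `(t, x) ↦ (e t
  -- x, s t x)`.
  have hlaw : Measurable fun q : Lp E 2 μ × Lp F 2 μ => μ.map (fun x => (q.1 x, q.2 x)) := by
    refine Measurable.measure_of_isPiSystem (S := {U | IsOpen U}) (BorelSpace.measurable_eq)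
      (fun U (hU : IsOpen U) V (hV : IsOpen V) _ => hU.inter hV)
      (fun U hU => (lowerSemicontinuous_measure_preimage hU).measurable)
      (lowerSemicontinuous_measure_preimage isOpen_univ).measurable
  have hq : AEMeasurable (fun t => (e t, s t)) ν := (he.prodMk hs).aemeasurable
  refine (((Measure.measurable_lintegral hh).comp hlaw).comp_aemeasurable hq).congr
    (Eventually.of_forall fun t => ?_)
  exact lintegral_map' hh.aemeasurable (aemeasurable_lp_pair (e t, s t))

end Nemytskii

/-! ### Paths of class `H¹` -/

section Paths

variable {W W' : Type*} [NormedAddCommGroup W] [NormedAddCommGroup W'] {T : ℝ}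

lemma memLp_of_continuousOn {w : ℝ → W} (hw : ContinuousOn w (Icc 0 T)) :
    MemLp w 2 ((volume : Measure ℝ).restrict (Icc 0 T)) := by
  obtain ⟨C, hC⟩ := isCompact_Icc.exists_bound_of_continuousOn hw
  refine MemLp.of_bound (hw.aestronglyMeasurable_of_isCompact isCompact_Icc measurableSet_Icc) C ?_
  exact (ae_restrict_iff' measurableSet_Icc).2 (Eventually.of_forall hC)

lemma intervalIntegrable_of_memLp {w : ℝ → W}
    (hw : MemLp w 2 ((volume : Measure ℝ).restrict (Icc 0 T))) {t : ℝ} (ht : t ∈ Icc 0 T) :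
    IntervalIntegrable w volume 0 t := by
  have h : IntegrableOn w (Icc 0 T) := hw.integrable (by norm_num)
  rw [intervalIntegrable_iff_integrableOn_Ioc_of_le ht.1]
  exact h.mono_set (Ioc_subset_Icc_self.trans (Icc_subset_Icc_right ht.2))

variable [NormedSpace ℝ W] [NormedSpace ℝ W']

lemma hasDerivAt_fst {z : ℝ → W × W'} {z' : W × W'} {t : ℝ} (h : HasDerivAt z z' t) :
    HasDerivAt (fun t => (z t).1) z'.1 t :=
  (ContinuousLinearMap.fst ℝ W W').hasFDerivAt.comp_hasDerivAt t h

lemma hasDerivAt_snd {z : ℝ → W × W'} {z' : W × W'} {t : ℝ} (h : HasDerivAt z z' t) :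
    HasDerivAt (fun t => (z t).2) z'.2 t :=
  (ContinuousLinearMap.snd ℝ W W').hasFDerivAt.comp_hasDerivAt t h

lemma memLp_prodMk {α : Type*} [MeasurableSpace α] {μ : Measure α} {p : ℝ≥0∞} {a : α → W}
    {b : α → W'} (ha : MemLp a p μ) (hb : MemLp b p μ) : MemLp (fun t => (a t, b t)) p μ := by
  have h := ((ContinuousLinearMap.inl ℝ W W').comp_memLp' ha).add
    ((ContinuousLinearMap.inr ℝ W W').comp_memLp' hb)
  refine h.ae_eq (Eventually.of_forall fun t => ?_)
  simp

lemma memLp_prodMk_prodMk {W₂ W₂' α : Type*} [NormedAddCommGroup W₂] [NormedAddCommGroup W₂']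
    [NormedSpace ℝ W₂] [NormedSpace ℝ W₂'] [MeasurableSpace α] {μ : Measure α} {p : ℝ≥0∞}
    {a : α → W} {b : α → W'} {c : α → W₂} {d : α → W₂'} (ha : MemLp a p μ) (hb : MemLp b p μ)
    (hc : MemLp c p μ) (hd : MemLp d p μ) : MemLp (fun t => ((a t, b t), (c t, d t))) p μ :=
  memLp_prodMk (memLp_prodMk ha hb) (memLp_prodMk hc hd)

lemma integral_congr_Icc {v w : ℝ → W} (h : v =ᵐ[(volume : Measure ℝ).restrict (Icc 0 T)] w)
    {t : ℝ} (ht : t ∈ Icc 0 T) : ∫ s in (0 : ℝ)..t, v s = ∫ s in (0 : ℝ)..t, w s := by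
  rw [intervalIntegral.integral_of_le ht.1, intervalIntegral.integral_of_le ht.1]
  exact integral_congr_ae
    (ae_restrict_of_ae_restrict_of_subset (Ioc_subset_Icc_self.trans (Icc_subset_Icc_right ht.2)) h)

namespace IsH1Path

/-- A path which is almost everywhere differentiable with derivative `w'` in `L²`, and the
primitive of `w'`, is of class `H¹`. -/
lemma of_hasDerivAt {w w' : ℝ → W}
    (hd : ∀ᵐ t ∂((volume : Measure ℝ).restrict (Icc 0 T)), HasDerivAt w (w' t) t)
    (hw' : MemLp w' 2 ((volume : Measure ℝ).restrict (Icc 0 T)))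
    (hi : ∀ t ∈ Icc 0 T, w t = w 0 + ∫ s in (0 : ℝ)..t, w' s) : IsH1Path T w where
  differentiable := hd.mono fun _ h => h.differentiableAt
  memLp := hw'.ae_eq (hd.mono fun _ h => h.deriv.symm)
  eq_integral t ht := by
    rw [hi t ht, integral_congr_Icc (hd.mono fun _ h => h.deriv.symm) ht]

lemma ae_hasDerivAt {w : ℝ → W} (h : IsH1Path T w) :
    ∀ᵐ t ∂((volume : Measure ℝ).restrict (Icc 0 T)), HasDerivAt w (deriv w t) t :=
  h.differentiable.mono fun _ h => h.hasDerivAt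

lemma clm [CompleteSpace W] [CompleteSpace W'] {w : ℝ → W} (h : IsH1Path T w) (L : W →L[ℝ] W') :
    IsH1Path T (fun t => L (w t)) := by
  refine of_hasDerivAt (w' := fun t => L (deriv w t))
    (h.ae_hasDerivAt.mono fun t ht => L.hasFDerivAt.comp_hasDerivAt t ht)
    (L.comp_memLp' h.memLp) fun t ht => ?_
  rw [L.intervalIntegral_comp_comm (intervalIntegrable_of_memLp h.memLp ht), ← map_add,
    ← h.eq_integral t ht]

lemma deriv_clm {w : ℝ → W} (h : IsH1Path T w) (L : W →L[ℝ] W') :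
    ∀ᵐ t ∂((volume : Measure ℝ).restrict (Icc 0 T)),
      deriv (fun t => L (w t)) t = L (deriv w t) :=
  h.ae_hasDerivAt.mono fun t ht => (L.hasFDerivAt.comp_hasDerivAt t ht).deriv

lemma add {v w : ℝ → W} (hv : IsH1Path T v) (hw : IsH1Path T w) :
    IsH1Path T (fun t => v t + w t) := by
  refine of_hasDerivAt (w' := fun t => deriv v t + deriv w t) ?_ (hv.memLp.add hw.memLp)
    fun t ht => ?_
  · filter_upwards [hv.ae_hasDerivAt, hw.ae_hasDerivAt] with t h1 h2 using h1.add h2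
  · rw [intervalIntegral.integral_add (intervalIntegrable_of_memLp hv.memLp ht)
      (intervalIntegrable_of_memLp hw.memLp ht), hv.eq_integral t ht, hw.eq_integral t ht]
    abel

lemma prodMk [CompleteSpace W] [CompleteSpace W'] {v : ℝ → W} {w : ℝ → W'} (hv : IsH1Path T v)
    (hw : IsH1Path T w) : IsH1Path T (fun t => (v t, w t)) := by
  simpa using (hv.clm (ContinuousLinearMap.inl ℝ W W')).add (hw.clm (ContinuousLinearMap.inr ℝ W W'))

lemma continuousOn {w : ℝ → W} (h : IsH1Path T w) : ContinuousOn w (Icc 0 T) := by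
  rcases lt_or_ge T 0 with hT | hT
  · simp [Icc_eq_empty_of_lt hT]
  have h1 : ContinuousOn (fun t => w 0 + ∫ s in (0 : ℝ)..t, deriv w s) (Icc 0 T) := by
    have := intervalIntegral.continuousOn_primitive_interval' (a := 0)
      (intervalIntegrable_of_memLp h.memLp (right_mem_Icc.2 hT)) left_mem_uIcc
    rw [uIcc_of_le hT] at this
    exact continuousOn_const.add this
  exact h1.congr h.eq_integral

lemma memLp_self {w : ℝ → W} (h : IsH1Path T w) :
    MemLp w 2 ((volume : Measure ℝ).restrict (Icc 0 T)) := memLp_of_continuousOn h.continuousOn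

end IsH1Path

lemma ae_hasDerivAt_primitive [CompleteSpace W] {w : ℝ → W} (hw : ContinuousOn w (Icc 0 T)) (c : W) :
    ∀ᵐ t ∂((volume : Measure ℝ).restrict (Icc 0 T)),
      HasDerivAt (fun t => c + ∫ s in (0 : ℝ)..t, w s) (w t) t := by
  -- The derivative is two-sided and `w` is controlled on `[0, T]` only; the endpoints are a null
  -- set.
  rw [← restrict_Ioo_eq_restrict_Icc, ae_restrict_iff' measurableSet_Ioo]
  refine Eventually.of_forall fun t ht => ?_
  have hc : ContinuousOn w (Ioo 0 T) := hw.mono Ioo_subset_Icc_self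
  exact (intervalIntegral.integral_hasDerivAt_right
    (intervalIntegrable_of_memLp (memLp_of_continuousOn hw) (Ioo_subset_Icc_self ht))
    (hc.stronglyMeasurableAtFilter isOpen_Ioo t ht)
    (hc.continuousAt (isOpen_Ioo.mem_nhds ht))).const_add c

lemma isH1Path_primitive [CompleteSpace W] {w : ℝ → W} (hw : ContinuousOn w (Icc 0 T)) (c : W) :
    IsH1Path T (fun t => c + ∫ s in (0 : ℝ)..t, w s) :=
  .of_hasDerivAt (ae_hasDerivAt_primitive hw c) (memLp_of_continuousOn hw) (by simp)

end Paths

/-! ### Quadratic forms on `L²` -/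

section LpInner

variable {α : Type*} [MeasurableSpace α] {μ : Measure α} {V : Type*} [NormedAddCommGroup V]
  [InnerProductSpace ℝ V]

lemma lp_inner_sub_right (a b c : Lp V 2 μ) : inner ℝ a (b - c) = inner ℝ a b - inner ℝ a c :=
  inner_sub_right a b c

lemma lp_inner_add_smul_right (a b c : Lp V 2 μ) (ε : ℝ) :
    inner ℝ a (b + ε • c) = inner ℝ a b + ε * inner ℝ a c := by
  rw [inner_add_right, real_inner_smul_right]

lemma lp_inner_zero_right (a : Lp V 2 μ) : inner ℝ a (0 : Lp V 2 μ) = 0 := inner_zero_right a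

lemma lp_inner_zero_left (a : Lp V 2 μ) : inner ℝ (0 : Lp V 2 μ) a = 0 := inner_zero_left a

/-- Serves both energies: `A` is the elasticity for the elastic one and the identity for the kinetic
one. -/
lemma inner_apply_add_smul {A : Lp V 2 μ → Lp V 2 μ} (hadd : ∀ a b, A (a + b) = A a + A b)
    (hsmul : ∀ (c : ℝ) a, A (c • a) = c • A a) (hA : ∀ a b, inner ℝ (A a) b = inner ℝ a (A b))
    (a b : Lp V 2 μ) (ε : ℝ) : inner ℝ (A (a + ε • b)) (a + ε • b) =
      inner ℝ (A a) a + 2 * ε * inner ℝ (A a) b + ε ^ 2 * inner ℝ (A b) b := by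
  have h : inner ℝ b (A a) = inner ℝ a (A b) := by rw [← hA, real_inner_comm]
  simp only [hadd, hsmul, inner_add_left, inner_add_right, real_inner_smul_left,
    real_inner_smul_right, hA, h]
  ring

end LpInner

namespace Body

variable (B : Body)

/-! ### The symplectic gradient of the Hamiltonian -/

/-- The elasticity `S⁻¹` acting on tensor fields. -/
noncomputable def elasticity : TensField B.Ω →L[ℝ] TensField B.Ω :=
  (B.S.symm : Sym3 →L[ℝ] Sym3).compLpL 2 ((volume : Measure E3).restrict B.Ω)

/-- The compliance `S` acting on tensor fields, as a continuous linear map. -/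
noncomputable def complianceL : TensField B.Ω →L[ℝ] TensField B.Ω :=
  (B.S : Sym3 →L[ℝ] Sym3).compLpL 2 ((volume : Measure E3).restrict B.Ω)

lemma stress_eq (z : ZState B.Ω) : B.stress z = B.elasticity (z.1.1.2.1 - z.1.2) := rfl

lemma compliance_eq (s : TensField B.Ω) : B.compliance s = B.complianceL s := rfl

lemma compliance_elasticity (s : TensField B.Ω) : B.complianceL (B.elasticity s) = s := by
  apply Lp.ext
  filter_upwards [(B.S : Sym3 →L[ℝ] Sym3).coeFn_compLp (B.elasticity s),
    (B.S.symm : Sym3 →L[ℝ] Sym3).coeFn_compLp s] with x h1 h2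
  exact h1.trans ((congrArg B.S h2).trans (B.S.apply_symm_apply _))

lemma elasticity_compliance (s : TensField B.Ω) : B.elasticity (B.complianceL s) = s := by
  apply Lp.ext
  filter_upwards [(B.S : Sym3 →L[ℝ] Sym3).coeFn_compLp s,
    (B.S.symm : Sym3 →L[ℝ] Sym3).coeFn_compLp (B.complianceL s)] with x h1 h2
  exact h2.trans ((congrArg B.S.symm h1).trans (B.S.symm_apply_apply _))

lemma inner_symm_comm (a b : Sym3) : inner ℝ (B.S.symm a) b = inner ℝ a (B.S.symm b) := by
  conv_lhs => rw [← B.S.apply_symm_apply b, ← B.S_symm, B.S.apply_symm_apply]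

lemma inner_elasticity_comm (a b : TensField B.Ω) :
    inner ℝ (B.elasticity a) b = inner ℝ a (B.elasticity b) := by
  rw [L2.inner_def, L2.inner_def]
  refine integral_congr_ae ?_
  filter_upwards [(B.S.symm : Sym3 →L[ℝ] Sym3).coeFn_compLp a,
    (B.S.symm : Sym3 →L[ℝ] Sym3).coeFn_compLp b] with x h1 h2
  have h1 : B.elasticity a x = B.S.symm (a x) := h1
  have h2 : B.elasticity b x = B.S.symm (b x) := h2
  rw [h1, h2, B.inner_symm_comm]

/-- The power of the surface forces. -/
noncomputable def surfaceWork (t : ℝ) (w : SurfField (frontier B.Ω)) : ℝ :=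
  ∫ x, inner ℝ (B.fbar t x) (w x) ∂((Measure.euclideanHausdorffMeasure 2 : Measure E3).restrict B.Γ₁)

lemma restrict_Γ₁_le : (Measure.euclideanHausdorffMeasure 2 : Measure E3).restrict B.Γ₁ ≤
    (Measure.euclideanHausdorffMeasure 2 : Measure E3).restrict (frontier B.Ω) :=
  Measure.restrict_mono (B.union_Γ ▸ subset_union_right) le_rfl

lemma restrict_Γ₀_le : (Measure.euclideanHausdorffMeasure 2 : Measure E3).restrict B.Γ₀ ≤
    (Measure.euclideanHausdorffMeasure 2 : Measure E3).restrict (frontier B.Ω) :=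
  Measure.restrict_mono (B.union_Γ ▸ subset_union_left) le_rfl

lemma integrable_surface (t : ℝ) (w : SurfField (frontier B.Ω)) :
    Integrable (fun x => (inner ℝ (B.fbar t x) (w x) : ℝ))
      ((Measure.euclideanHausdorffMeasure 2 : Measure E3).restrict B.Γ₁) := by
  have hw := (Lp.memLp w).mono_measure B.restrict_Γ₁_le
  refine (L2.integrable_inner (𝕜 := ℝ) (B.fbar t) (hw.toLp w)).congr ?_
  filter_upwards [hw.coeFn_toLp] with x hx
  rw [hx]

lemma surfaceWork_add_smul (t ε : ℝ) (w w' : SurfField (frontier B.Ω)) :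
    B.surfaceWork t (w + ε • w') = B.surfaceWork t w + ε * B.surfaceWork t w' := by
  unfold surfaceWork
  rw [← integral_const_mul, ← integral_add (B.integrable_surface t w)
    ((B.integrable_surface t w').const_mul ε)]
  refine integral_congr_ae ?_
  filter_upwards [(Lp.coeFn_add w (ε • w')).filter_mono (ae_mono B.restrict_Γ₁_le),
    (Lp.coeFn_smul ε w').filter_mono (ae_mono B.restrict_Γ₁_le)] with x h1 h2
  rw [h1, Pi.add_apply, h2, Pi.smul_apply, inner_add_right, inner_smul_right]

lemma surfaceWork_zero (t : ℝ) : B.surfaceWork t 0 = 0 := by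
  have := B.surfaceWork_add_smul t 1 0 0
  simp only [smul_zero, add_zero, one_mul] at this
  linarith

/-- The bilinear form of the elastic energy. -/
noncomputable def elasticForm (a b : TensField B.Ω) : ℝ := inner ℝ (B.elasticity a) b

/-- The work of the volume forces. -/
noncomputable def volumeWork (t : ℝ) (u : VecField B.Ω) : ℝ := inner ℝ (B.f t) u

lemma volumeWork_add_smul (t ε : ℝ) (u v : VecField B.Ω) :
    B.volumeWork t (u + ε • v) = B.volumeWork t u + ε * B.volumeWork t v :=
  lp_inner_add_smul_right (B.f t) u v ε

lemma elasticForm_add_smul (a b : TensField B.Ω) (ε : ℝ) :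
    B.elasticForm (a + ε • b) (a + ε • b) =
      B.elasticForm a a + 2 * ε * B.elasticForm a b + ε ^ 2 * B.elasticForm b b :=
  inner_apply_add_smul (fun a b => map_add B.elasticity a b)
    (fun c a => map_smul B.elasticity c a) B.inner_elasticity_comm a b ε

lemma hamiltonian_eq (t : ℝ) (z : ZState B.Ω) : B.hamiltonian t z =
    1 / (2 * B.ρ) * inner ℝ z.2.1 z.2.1
      + 1 / 2 * B.elasticForm (z.1.1.2.1 - z.1.2) (z.1.1.2.1 - z.1.2)
      - B.volumeWork t z.1.1.1 - B.surfaceWork t z.1.1.2.2 := by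
  unfold hamiltonian
  rw [← surfaceWork]
  congr 1
  simp only [elasticForm, volumeWork, L2.inner_def]
  rw [← integral_const_mul, ← integral_const_mul, ← integral_add, ← integral_sub]
  · refine integral_congr_ae ?_
    filter_upwards [Lp.coeFn_sub z.1.1.2.1 z.1.2,
      (B.S.symm : Sym3 →L[ℝ] Sym3).coeFn_compLp (z.1.1.2.1 - z.1.2)] with x h1 h2
    have h2 : B.elasticity (z.1.1.2.1 - z.1.2) x = B.S.symm ((z.1.1.2.1 - z.1.2) x) := h2
    rw [h2, h1, energy, Pi.sub_apply, real_inner_self_eq_norm_sq, B.inner_symm_comm]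
  · exact ((L2.integrable_inner _ _).const_mul _).add ((L2.integrable_inner _ _).const_mul _)
  · exact L2.integrable_inner _ _
  · exact (L2.integrable_inner _ _).const_mul _
  · exact (L2.integrable_inner _ _).const_mul _

/-- The directional derivative of the Hamiltonian. -/
noncomputable def hamiltonianDeriv (t : ℝ) (z ζ : ZState B.Ω) : ℝ :=
  1 / B.ρ * inner ℝ z.2.1 ζ.2.1 + B.elasticForm (z.1.1.2.1 - z.1.2) (ζ.1.1.2.1 - ζ.1.2)
    - B.volumeWork t ζ.1.1.1 - B.surfaceWork t ζ.1.1.2.2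

/-- A quadratic form plus a linear one expands exactly along a line, so the difference quotient is
affine in `ε` and its limit is immediate. -/
lemma hamiltonian_add_smul (t ε : ℝ) (z ζ : ZState B.Ω) : B.hamiltonian t (z + ε • ζ) =
    B.hamiltonian t z + ε * B.hamiltonianDeriv t z ζ + ε ^ 2 * (1 / (2 * B.ρ) * inner ℝ ζ.2.1 ζ.2.1
      + 1 / 2 * B.elasticForm (ζ.1.1.2.1 - ζ.1.2) (ζ.1.1.2.1 - ζ.1.2)) := by
  have e : (z + ε • ζ).1.1.2.1 - (z + ε • ζ).1.2 =
      (z.1.1.2.1 - z.1.2) + ε • (ζ.1.1.2.1 - ζ.1.2) := by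
    simp only [Prod.fst_add, Prod.snd_add, Prod.smul_fst, Prod.smul_snd, smul_sub]
    abel
  rw [hamiltonian_eq, hamiltonian_eq, e, hamiltonianDeriv]
  simp only [Prod.fst_add, Prod.snd_add, Prod.smul_fst, Prod.smul_snd, surfaceWork_add_smul,
    volumeWork_add_smul, elasticForm_add_smul]
  have hp := inner_apply_add_smul (A := fun a : VecField B.Ω => a) (fun _ _ => rfl)
    (fun _ _ => rfl) (fun _ _ => rfl) z.2.1 ζ.2.1 ε
  rw [hp]
  have := B.ρ_pos.ne'
  field_simp
  ring

lemma tendsto_hamiltonian (t : ℝ) (z ζ : ZState B.Ω) :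
    Tendsto (fun ε : ℝ => (1 / ε) * (B.hamiltonian t (z + ε • ζ) - B.hamiltonian t z))
      (𝓝[≠] 0) (𝓝 (B.hamiltonianDeriv t z ζ)) := by
  set q : ℝ := 1 / (2 * B.ρ) * inner ℝ ζ.2.1 ζ.2.1
      + 1 / 2 * B.elasticForm (ζ.1.1.2.1 - ζ.1.2) (ζ.1.1.2.1 - ζ.1.2) with hq
  have h : Tendsto (fun ε : ℝ => B.hamiltonianDeriv t z ζ + ε * q) (𝓝[≠] 0)
      (𝓝 (B.hamiltonianDeriv t z ζ)) := by
    refine tendsto_nhdsWithin_of_tendsto_nhds ?_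
    have : Continuous fun ε : ℝ => B.hamiltonianDeriv t z ζ + ε * q := by fun_prop
    simpa using this.tendsto 0
  refine h.congr' ?_
  filter_upwards [self_mem_nhdsWithin] with ε hε
  have hε : ε ≠ 0 := hε
  rw [hamiltonian_add_smul, ← hq]
  field_simp
  ring

lemma isSymplecticGradient_iff_deriv (t : ℝ) (z : ZState B.Ω) (X : ZField B.Ω) :
    B.IsSymplecticGradient t z X ↔ ∀ ζ : ZState B.Ω, ζ.1.1 ∈ B.virtualDisp →
      sympForm prodInner X (toField ζ) = B.hamiltonianDeriv t z ζ :=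
  forall₂_congr fun ζ _ =>
    ⟨fun h => tendsto_nhds_unique h (B.tendsto_hamiltonian t z ζ),
      fun h => h ▸ B.tendsto_hamiltonian t z ζ⟩

/-- Allows variations of `εᵖ`, `p` or `π` alone as tests. -/
lemma zero_mem_virtualDisp : (0 : DispTriple B.Ω) ∈ B.virtualDisp := by
  refine ⟨subset_closure ⟨0, contDiff_const, Lp.coeFn_zero _ _ _, ?_, Lp.coeFn_zero _ _ _⟩,
    (Lp.coeFn_zero E3 2 _).filter_mono (ae_mono B.restrict_Γ₀_le)⟩
  filter_upwards [Lp.coeFn_zero Sym3 2 ((volume : Measure E3).restrict B.Ω)] with x hx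
  refine hx.trans ?_
  apply Subtype.ext
  ext k
  simp [symGrad]

/-- The symplectic gradient of the Hamiltonian. -/
lemma isSymplecticGradient_iff (t : ℝ) (z : ZState B.Ω) (X : ZField B.Ω) :
    B.IsSymplecticGradient t z X ↔
      B.ρ • X.1.1 = z.2.1 ∧ X.1.2 = 0 ∧ X.2.2 = B.stress z ∧
        B.IsDivergence t (B.stress z) (X.2.1 - B.f t) := by
  rw [isSymplecticGradient_iff_deriv]
  have hρ := B.ρ_pos.ne'
  have key : ∀ ζ : ZState B.Ω, sympForm prodInner X (toField ζ) = B.hamiltonianDeriv t z ζ ↔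
      inner ℝ X.1.1 ζ.2.1 + inner ℝ X.1.2 ζ.2.2 - (inner ℝ X.2.1 ζ.1.1.1 + inner ℝ X.2.2 ζ.1.2) =
        1 / B.ρ * inner ℝ z.2.1 ζ.2.1 +
          (inner ℝ (B.stress z) ζ.1.1.2.1 - inner ℝ (B.stress z) ζ.1.2)
          - inner ℝ (B.f t) ζ.1.1.1 - B.surfaceWork t ζ.1.1.2.2 := fun ζ => by
    rw [hamiltonianDeriv, elasticForm, lp_inner_sub_right, sympForm,
      prodInner_comm (toField ζ).1 X.2]
    rfl
  simp only [key]
  constructor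
  · intro h
    refine ⟨?_, ?_, ?_, ?_⟩
    -- One slot is tested at a time: varying `p`, `π`, `εᵖ` determines the components of `X` along
    -- `u`, `εᵖ`, `π`. Only the variation of `u` is restricted, to virtual displacements, so it
    -- yields a weak equation.
    · refine ext_inner_right ℝ fun w => ?_
      have := h ((0, 0), (w, 0)) B.zero_mem_virtualDisp
      simp only [Prod.fst_zero, Prod.snd_zero, lp_inner_zero_right,
        surfaceWork_zero] at this
      rw [real_inner_smul_left]
      field_simp at this
      linarith
    · refine ext_inner_right ℝ fun w => ?_
      have := h ((0, 0), (0, w)) B.zero_mem_virtualDisp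
      simp only [Prod.fst_zero, Prod.snd_zero, lp_inner_zero_right,
        surfaceWork_zero] at this
      rw [lp_inner_zero_left]
      linarith
    · refine ext_inner_right ℝ fun w => ?_
      have := h ((0, w), (0, 0)) B.zero_mem_virtualDisp
      simp only [Prod.fst_zero, Prod.snd_zero, lp_inner_zero_right,
        surfaceWork_zero] at this
      linarith
    · intro v hv
      have := h ((v, 0), (0, 0)) hv
      simp only [lp_inner_zero_right] at this
      rw [← surfaceWork, inner_sub_left]
      linarith
  · rintro ⟨h1, h2, h3, h4⟩ ζ hζ
    have h5 := h4 _ hζ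
    rw [← surfaceWork, inner_sub_left] at h5
    rw [h2, h3, ← h1, lp_inner_zero_left, real_inner_smul_left, ← h5]
    field_simp
    ring

end Body

/-! ### Uniqueness of the divergence -/

lemma continuous_symGrad {φ : E3 → E3} (hφ : ContDiff ℝ ∞ φ) : Continuous (symGrad φ) := by
  have h : Continuous (fderiv ℝ φ) := hφ.continuous_fderiv (by simp)
  refine Continuous.subtype_mk ((PiLp.continuous_toLp 2 _).comp (continuous_pi fun k => ?_)) _
  fun_prop

lemma symGrad_of_notMem_tsupport {φ : E3 → E3} {x : E3} (hx : x ∉ tsupport φ) :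
    symGrad φ x = 0 := by
  have h : fderiv ℝ φ x = 0 := by
    by_contra h
    exact hx (support_fderiv_subset ℝ h)
  apply Subtype.ext
  ext k
  simp [symGrad, h]

namespace Body

variable (B : Body)

instance isFiniteMeasure_restrict : IsFiniteMeasure ((volume : Measure E3).restrict B.Ω) :=
  ⟨by simpa using B.bounded_Ω.measure_lt_top⟩

instance isFiniteMeasure_space : IsFiniteMeasure B.space := B.isFiniteMeasure_restrict

/-- Smooth fields with compact support in the domain are virtual displacements. -/
lemma exists_virtualDisp_of_hasCompactSupport {φ : E3 → E3} (hφ : ContDiff ℝ ∞ φ)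
    (hc : HasCompactSupport φ) (hs : tsupport φ ⊆ B.Ω) :
    ∃ v ∈ B.virtualDisp, v.1 =ᵐ[(volume : Measure E3).restrict B.Ω] φ := by
  have h1 : MemLp φ 2 ((volume : Measure E3).restrict B.Ω) :=
    hφ.continuous.memLp_of_hasCompactSupport hc
  have h2 : MemLp (symGrad φ) 2 ((volume : Measure E3).restrict B.Ω) :=
    (continuous_symGrad hφ).memLp_of_hasCompactSupport
      (HasCompactSupport.intro hc fun x hx => symGrad_of_notMem_tsupport hx)
  refine ⟨(h1.toLp φ, h2.toLp _, 0), ⟨subset_closure ⟨φ, hφ, h1.coeFn_toLp, h2.coeFn_toLp, ?_⟩,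
    (Lp.coeFn_zero E3 2 _).filter_mono (ae_mono B.restrict_Γ₀_le)⟩, h1.coeFn_toLp⟩
  -- The support lies in the open set `Ω`, which is disjoint from its frontier; the trace is
  -- therefore zero.
  filter_upwards [Lp.coeFn_zero E3 2 _, ae_restrict_mem isClosed_frontier.measurableSet] with x hx hxf
  have : x ∉ B.Ω := fun h => by
    rw [B.isOpen_Ω.frontier_eq] at hxf
    exact hxf.2 h
  exact hx.trans (image_eq_zero_of_notMem_tsupport fun h => this (hs h)).symm

/-- Test fields compactly supported in `Ω` determine `d` by the fundamental lemma of the calculus of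
variations. Uniqueness identifies the `d` that `Constraints` merely asserts to exist with the one
occurring in `X_H`. -/
lemma IsDivergence.unique {B : Body} {t : ℝ} {s : TensField B.Ω} {d d' : VecField B.Ω}
    (h : B.IsDivergence t s d) (h' : B.IsDivergence t s d') : d = d' := by
  have hint : Integrable (d - d' : VecField B.Ω) ((volume : Measure E3).restrict B.Ω) :=
    (Lp.memLp (d - d')).integrable (by norm_num)
  have key : ∀ᵐ x ∂(volume : Measure E3).restrict B.Ω, x ∈ B.Ω → (d - d' : VecField B.Ω) x = 0 := by
    refine B.isOpen_Ω.ae_eq_zero_of_integral_contDiff_smul_eq_zero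
      (hint.locallyIntegrable.locallyIntegrableOn _) fun g hg hgc hgs => ?_
    -- The fundamental lemma uses scalar test functions `g`; pairing with a constant vector `c`
    -- gives the vector test field `g • c`.
    refine integral_eq_zero_of_forall_integral_inner_eq_zero (𝕜 := ℝ) _
      (hint.locallyIntegrable.integrable_smul_left_of_hasCompactSupport hg.continuous hgc)
      fun c => ?_
    have hts : tsupport (fun x => g x • c) ⊆ tsupport g := tsupport_smul_subset_left g fun _ => c
    obtain ⟨v, hv, hvφ⟩ := B.exists_virtualDisp_of_hasCompactSupport
      (φ := fun x => g x • c) (hg.smul contDiff_const)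
      (hgc.smul_right (f' := fun _ => c)) (hts.trans hgs)
    have e : inner ℝ d v.1 = inner ℝ d' v.1 := by linarith [h v hv, h' v hv]
    have e' : inner ℝ (d - d') v.1 = 0 := by rw [inner_sub_left, e, sub_self]
    rw [L2.inner_def] at e'
    rw [← e']
    refine integral_congr_ae ?_
    filter_upwards [hvφ] with x hx
    rw [hx, inner_smul_right, inner_smul_right, real_inner_comm]
  rw [← sub_eq_zero]
  apply Lp.ext
  filter_upwards [key, ae_restrict_mem B.isOpen_Ω.measurableSet, Lp.coeFn_zero E3 2 _] with x h1 h2 h3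
  rw [h1 h2, h3, Pi.zero_apply]

end Body

namespace Body

variable (B : Body) {bp : Sym3 → Sym3 → EReal}

/-! ### The reduced functional -/

/-- The defect `∫_Ω (b_p(e, s) - e : s) dΩ`. -/
noncomputable def gap (bp : Sym3 → Sym3 → EReal) (e s : TensField B.Ω) : ℝ≥0∞ :=
  ∫⁻ x, (bp (e x) (s x) - ((inner ℝ (e x) (s x) : ℝ) : EReal)).toENNReal ∂B.space

lemma measurable_gap_integrand (hmeas : Measurable (Function.uncurry bp)) :
    Measurable fun q : Sym3 × Sym3 =>
      (bp q.1 q.2 - ((inner ℝ q.1 q.2 : ℝ) : EReal)).toENNReal := by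
  have h1 : Measurable fun q : Sym3 × Sym3 => bp q.1 q.2 := hmeas
  have h2 : Measurable fun q : Sym3 × Sym3 => -((inner ℝ q.1 q.2 : ℝ) : EReal) :=
    continuous_neg.measurable.comp
      (Continuous.measurable (by fun_prop : Continuous fun q : Sym3 × Sym3 => (inner ℝ q.1 q.2 : ℝ))
        |>.coe_real_ereal)
  simp only [sub_eq_add_neg]
  exact (h1.add h2).ereal_toENNReal

section

variable (hbp : IsBipotential (fun e s : Sym3 => (inner ℝ e s : ℝ)) bp)
  (hmeas : Measurable (Function.uncurry bp))
include hbp hmeas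

/-- The product `e : s` of two `L²` fields is integrable and lies below `bp`, so the subtraction
passes under the integral. -/
lemma reducedBHat_sub_inner (e s : TensField B.Ω) :
    B.reducedBHat bp e s - ((inner ℝ e s : ℝ) : EReal) = (B.gap bp e s : EReal) := by
  rw [L2.inner_def]
  exact eIntegral_sub_integral (hmeas.comp_aemeasurable (aemeasurable_lp_pair (e, s)))
    (L2.integrable_inner (𝕜 := ℝ) e s) fun x => hbp.fenchel (e x) (s x)

lemma gap_eq_zero_iff (e s : TensField B.Ω) : B.gap bp e s = 0 ↔
    ∀ᵐ x ∂B.space, bp (e x) (s x) = ((inner ℝ (e x) (s x) : ℝ) : EReal) := by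
  have hm : AEMeasurable
      (fun x => (bp (e x) (s x) - ((inner ℝ (e x) (s x) : ℝ) : EReal)).toENNReal) B.space :=
    (measurable_gap_integrand hmeas).comp_aemeasurable (aemeasurable_lp_pair (e, s))
  rw [gap, lintegral_eq_zero_iff' hm]
  refine eventually_congr (Eventually.of_forall fun x => ?_)
  rw [Pi.zero_apply, EReal.toENNReal_eq_zero_iff, EReal.sub_nonpos]
  exact ⟨fun h => h.antisymm (hbp.fenchel _ _), fun h => h.le⟩

lemma functional_eq (u : ℝ → DispTriple B.Ω) (σ : ℝ → TensField B.Ω) :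
    B.functional bp u σ = ((∫⁻ t, B.gap bp (B.plasticRate u σ t) (σ t) ∂B.time : ℝ≥0∞) : EReal) := by
  rw [functional, ← eIntegral_coe_ennreal]
  simp only [B.reducedBHat_sub_inner hbp hmeas]

lemma functional_nonneg (u : ℝ → DispTriple B.Ω) (σ : ℝ → TensField B.Ω) :
    0 ≤ B.functional bp u σ := by
  rw [B.functional_eq hbp hmeas]
  exact EReal.coe_ennreal_nonneg _

/-- A nonnegative integral vanishes iff its integrand does almost everywhere, used first in time and
then in space. The first use needs the gap to be measurable in time. -/
lemma functional_eq_zero_iff {u : ℝ → DispTriple B.Ω} {σ : ℝ → TensField B.Ω}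
    (hu : IsH1Path B.T u) (hσ : IsH1Path B.T σ) :
    B.functional bp u σ = 0 ↔ B.FlowRule bp u σ := by
  have he : AEStronglyMeasurable (B.plasticRate u σ) B.time := by
    have h1 : AEStronglyMeasurable (fun t => (deriv u t).2.1) B.time :=
      (by fun_prop : Continuous fun w : DispTriple B.Ω => w.2.1).comp_aestronglyMeasurable
        hu.memLp.aestronglyMeasurable
    exact h1.sub (B.complianceL.continuous.comp_aestronglyMeasurable hσ.memLp.aestronglyMeasurable)
  have hs : AEStronglyMeasurable σ B.time := hσ.memLp_self.aestronglyMeasurable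
  have hm : AEMeasurable (fun t => B.gap bp (B.plasticRate u σ t) (σ t)) B.time :=
    aemeasurable_lintegral_comp he hs (measurable_gap_integrand hmeas)
  rw [B.functional_eq hbp hmeas, EReal.coe_ennreal_eq_zero, lintegral_eq_zero_iff' hm]
  refine eventually_congr (Eventually.of_forall fun t => ?_)
  rw [Pi.zero_apply, B.gap_eq_zero_iff hbp hmeas]
  exact eventually_congr (Eventually.of_forall fun x => hbp.extremal_right _ _)

end

/-! ### Reduction of the functional in phase space -/

/-- All components of the irreversible rate vanish except the plastic strain rate. -/
def IsPlastic {Ω : Set E3} (zI : ZField Ω) : Prop := zI.1.1 = 0 ∧ zI.2.1 = 0 ∧ zI.2.2 = 0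

lemma ae_of_isPlastic {zI : ZField B.Ω} (h : IsPlastic zI) : ∀ᵐ x ∂B.space,
    (evalAt zI x).1.1 = 0 ∧ (evalAt zI x).2.1 = 0 ∧ (evalAt zI x).2.2 = 0 := by
  obtain ⟨h1, h2, h3⟩ := h
  filter_upwards [Lp.coeFn_zero E3 2 ((volume : Measure E3).restrict B.Ω),
    Lp.coeFn_zero Sym3 2 ((volume : Measure E3).restrict B.Ω)] with x hx hx'
  simp only [evalAt, h1, h2, h3]
  exact ⟨hx, hx, hx'⟩

lemma isPlastic_of_ae {zI : ZField B.Ω} (h : ∀ᵐ x ∂B.space,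
    (evalAt zI x).1.1 = 0 ∧ (evalAt zI x).2.1 = 0 ∧ (evalAt zI x).2.2 = 0) : IsPlastic zI :=
  ⟨(Lp.eq_zero_iff_ae_eq_zero).2 (h.mono fun _ h => h.1),
    (Lp.eq_zero_iff_ae_eq_zero).2 (h.mono fun _ h => h.2.1),
    (Lp.eq_zero_iff_ae_eq_zero).2 (h.mono fun _ h => h.2.2)⟩

lemma sympForm_of_isPlastic {zI : ZField B.Ω} (h : IsPlastic zI) (z : ZField B.Ω) :
    sympForm prodInner zI z = inner ℝ zI.1.2 z.2.2 := by
  obtain ⟨h1, h2, h3⟩ := h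
  simp only [sympForm, prodInner, h1, h2, h3, lp_inner_zero_left, lp_inner_zero_right]
  ring

section

variable (hbp : IsBipotential (fun e s : Sym3 => (inner ℝ e s : ℝ)) bp)
include hbp

lemma bHat_eq_of_plastic {zI : ZPt} (h : zI.1.1 = 0 ∧ zI.2.1 = 0 ∧ zI.2.2 = 0) (z : ZPt) :
    bHat bp zI z = bp zI.1.2 z.2.2 := by
  rw [bHat, bZ_eq hbp, if_pos]
  · rfl
  · simp [Jinv, h.1, h.2.1, h.2.2]

lemma bHat_eq_top_of_not_plastic {zI : ZPt} (h : ¬(zI.1.1 = 0 ∧ zI.2.1 = 0 ∧ zI.2.2 = 0))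
    (z : ZPt) : bHat bp zI z = ⊤ := by
  rw [bHat, bZ_eq hbp, if_neg]
  simp only [Jinv, Prod.fst_neg, Prod.snd_neg, neg_eq_zero]
  tauto

lemma phaseBHat_of_isPlastic {zI : ZField B.Ω} (h : IsPlastic zI) (z : ZField B.Ω) :
    B.phaseBHat bp zI z = B.reducedBHat bp zI.1.2 z.2.2 :=
  eIntegral_congr_ae ((B.ae_of_isPlastic h).mono fun _ hx => bHat_eq_of_plastic hbp hx _)

/-- A nonzero `L²` class is nonzero on a non-null set, where `b̂ = +∞`; the symplectic form of the
two fields is an integrable minorant. -/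
lemma phaseBHat_of_not_isPlastic {zI : ZField B.Ω} (h : ¬IsPlastic zI) (z : ZField B.Ω) :
    B.phaseBHat bp zI z = ⊤ := by
  have hint : Integrable (fun x => sympForm prodInner (evalAt zI x) (evalAt z x)) B.space :=
    ((L2.integrable_inner zI.1.1 z.2.1).add (L2.integrable_inner zI.1.2 z.2.2)).sub
      ((L2.integrable_inner z.1.1 zI.2.1).add (L2.integrable_inner z.1.2 zI.2.2))
  refine eIntegral_eq_top hint (fun x => (isSymplecticBipotential_bHat hbp).fenchel _ _)
    (s := {x | ¬((evalAt zI x).1.1 = 0 ∧ (evalAt zI x).2.1 = 0 ∧ (evalAt zI x).2.2 = 0)})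
    ?_ (fun h0 => h (B.isPlastic_of_ae h0)) fun x hx => bHat_eq_top_of_not_plastic hbp hx _
  have hE : ∀ w : VecField B.Ω, NullMeasurableSet {x | w x = 0} B.space := fun w =>
    (Lp.aestronglyMeasurable w).nullMeasurableSet_eq_fun aestronglyMeasurable_const
  have hS : NullMeasurableSet {x | zI.2.2 x = 0} B.space :=
    (Lp.aestronglyMeasurable zI.2.2).nullMeasurableSet_eq_fun aestronglyMeasurable_const
  exact ((hE zI.1.1).inter ((hE zI.2.1).inter hS)).compl

end

end Body

namespace Body

variable {B : Body} {bp : Sym3 → Sym3 → EReal}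

/-! ### Phase paths and admissible paths -/

/-- The displacement part of a state, as a continuous linear map. -/
noncomputable def dispL (B : Body) : ZState B.Ω →L[ℝ] DispTriple B.Ω :=
  (ContinuousLinearMap.fst ℝ _ _).comp (ContinuousLinearMap.fst ℝ _ _)

/-- The momentum of a state, as a continuous linear map. -/
noncomputable def momentumL (B : Body) : ZState B.Ω →L[ℝ] VecField B.Ω :=
  (ContinuousLinearMap.fst ℝ _ _).comp (ContinuousLinearMap.snd ℝ _ _)

/-- The strain of a displacement triple, as a continuous linear map. -/
noncomputable def strainL (B : Body) : DispTriple B.Ω →L[ℝ] TensField B.Ω :=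
  (ContinuousLinearMap.fst ℝ _ _).comp (ContinuousLinearMap.snd ℝ _ _)

/-- The elasticity law as a continuous linear map on states. -/
noncomputable def stressL (B : Body) : ZState B.Ω →L[ℝ] TensField B.Ω :=
  B.elasticity.comp ((B.strainL.comp B.dispL) -
    (ContinuousLinearMap.snd ℝ _ _).comp (ContinuousLinearMap.fst ℝ _ _))

/-- The field underlying a state, as a continuous linear map. -/
noncomputable def toFieldL (B : Body) : ZState B.Ω →L[ℝ] ZField B.Ω :=
  (((ContinuousLinearMap.fst ℝ _ _).comp B.dispL).prod
    ((ContinuousLinearMap.snd ℝ _ _).comp (ContinuousLinearMap.fst ℝ _ _))).prod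
      (ContinuousLinearMap.snd ℝ _ _)

namespace IsPhasePath

variable {z : ℝ → ZState B.Ω} {X : ℝ → ZField B.Ω} (h : B.IsPhasePath z X)
include h

lemma stress_h1 : IsH1Path B.T (fun t => B.stress (z t)) :=
  IsH1Path.clm (W := ZState B.Ω) (W' := TensField B.Ω) h.h1 B.stressL

lemma ae_deriv_disp : ∀ᵐ t ∂B.time, deriv (fun t => (z t).1.1) t = (deriv z t).1.1 :=
  IsH1Path.deriv_clm (W := ZState B.Ω) (W' := DispTriple B.Ω) h.h1 B.dispL

/-- Differentiating `S : σ = ∇u - εᵖ` in time gives `S : σ̇ = ∇u̇ - ε̇ᵖ`. -/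
lemma ae_plasticRate : ∀ᵐ t ∂B.time,
    B.plasticRate (fun t => (z t).1.1) (fun t => B.stress (z t)) t = (B.rate z t).1.2 := by
  filter_upwards [h.ae_deriv_disp,
    IsH1Path.deriv_clm (W := ZState B.Ω) (W' := TensField B.Ω) h.h1 B.stressL] with t h1 h2
  have h2 : deriv (fun t => B.stress (z t)) t = B.stress (deriv z t) := h2
  rw [plasticRate, h1, h2, compliance_eq, stress_eq, compliance_elasticity, sub_sub_cancel]
  rfl

lemma ae_gradient : ∀ᵐ t ∂B.time, B.ρ • (X t).1.1 = (z t).2.1 ∧ (X t).1.2 = 0 ∧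
    (X t).2.2 = B.stress (z t) ∧ B.IsDivergence t (B.stress (z t)) ((X t).2.1 - B.f t) :=
  h.gradient.mono fun _ ht => (B.isSymplecticGradient_iff _ _ _).1 ht

/-- By the formula for `X_H`, each constraint is the vanishing of one component of `ż - X_H`; for
the momentum this uses uniqueness of the weak divergence. -/
lemma constraints_iff : B.Constraints z ↔ ∀ᵐ t ∂B.time, IsPlastic (B.irrev z X t) := by
  refine eventually_congr ?_
  filter_upwards [h.ae_gradient] with t ⟨h1, _, h3, h4⟩
  have e1 : (B.irrev z X t).1.1 = (B.rate z t).1.1 - (X t).1.1 := rfl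
  have e2 : (B.irrev z X t).2.1 = (B.rate z t).2.1 - (X t).2.1 := rfl
  have e3 : (B.irrev z X t).2.2 = (B.rate z t).2.2 - (X t).2.2 := rfl
  rw [IsPlastic, e1, e2, e3, sub_eq_zero, sub_eq_zero, sub_eq_zero, h3, ← h1,
    (smul_right_injective _ B.ρ_pos.ne').eq_iff]
  refine and_congr eq_comm (and_congr ⟨?_, fun hp => ⟨_, h4, ?_⟩⟩ Iff.rfl)
  · rintro ⟨d, hd, hdp⟩
    rw [← hdp, hd.unique h4, sub_add_cancel]
  · rw [sub_add_cancel, hp]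

lemma aestronglyMeasurable_irrev : AEStronglyMeasurable (B.irrev z X) B.time :=
  (B.toFieldL.continuous.comp_aestronglyMeasurable h.h1.memLp.aestronglyMeasurable).sub
    h.gradient_memLp.aestronglyMeasurable

variable (hbp : IsBipotential (fun e s : Sym3 => (inner ℝ e s : ℝ)) bp)
include hbp

/-- Only the pairing of `ε̇ᵖ` with `π̇` survives, and `π̇ = σ`. -/
lemma phaseFunctional_of_constraints (hc : B.Constraints z) : B.phaseFunctional bp z X =
    B.functional bp (fun t => (z t).1.1) (fun t => B.stress (z t)) := by
  refine eIntegral_congr_ae ?_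
  filter_upwards [h.constraints_iff.1 hc, hc, h.ae_gradient, h.ae_plasticRate]
    with t hp ⟨_, _, hσ⟩ ⟨_, hX, _, _⟩ hpl
  have e : (B.irrev z X t).1.2 = (B.rate z t).1.2 := by
    have : (B.irrev z X t).1.2 = (B.rate z t).1.2 - (X t).1.2 := rfl
    rw [this, hX, sub_zero]
  rw [B.phaseBHat_of_isPlastic hbp hp, B.sympForm_of_isPlastic hp, e, hσ, hpl]

/-- At a point the inclusion splits into the vanishing of three components and the extremality of
`bp` at `(ε̇ᵖ, π̇)`. The first half, over `Ω`, is the constraints; they replace `π̇` by `σ` in the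
second. -/
lemma hamiltonianInclusion_iff : B.HamiltonianInclusion bp z X ↔ B.Constraints z ∧
    B.FlowRule bp (fun t => (z t).1.1) (fun t => B.stress (z t)) := by
  rw [h.constraints_iff, FlowRule, ← eventually_and]
  refine eventually_congr ?_
  filter_upwards [h.ae_gradient, h.ae_plasticRate] with t ⟨_, hX, hXσ, _⟩ hpl
  have e1 : (B.irrev z X t).1.2 = (B.rate z t).1.2 - (X t).1.2 := rfl
  have e2 : (B.irrev z X t).2.2 = (B.rate z t).2.2 - (X t).2.2 := rfl
  rw [hX, sub_zero] at e1
  rw [hXσ] at e2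
  have hflow : IsPlastic (B.irrev z X t) → ∀ x,
      (bp (evalAt (B.irrev z X t) x).1.2 (evalAt (B.rate z t) x).2.2 =
        ((inner ℝ (evalAt (B.irrev z X t) x).1.2 (evalAt (B.rate z t) x).2.2 : ℝ) : EReal) ↔
      (B.rate z t).1.2 x ∈ subdiff (fun h d => inner ℝ d h)
        (fun s => bp ((B.rate z t).1.2 x) s) (B.stress (z t) x)) := fun hp x => by
    have e3 : (B.rate z t).2.2 = B.stress (z t) := sub_eq_zero.1 (e2 ▸ hp.2.2)
    have e4 : (evalAt (B.irrev z X t) x).1.2 = (B.rate z t).1.2 x := by rw [← e1]; rfl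
    have e5 : (evalAt (B.rate z t) x).2.2 = B.stress (z t) x := by rw [← e3]; rfl
    rw [e4, e5]
    exact hbp.extremal_right _ _
  simp only [mem_sympSubdiff_bHat_iff hbp, hpl]
  rw [eventually_and]
  constructor
  · rintro ⟨hp, hf⟩
    have hp := B.isPlastic_of_ae hp
    exact ⟨hp, hf.mono fun x hx => (hflow hp x).1 hx⟩
  · rintro ⟨hp, hf⟩
    exact ⟨B.ae_of_isPlastic hp, hf.mono fun x hx => (hflow hp x).2 hx⟩

variable (hmeas : Measurable (Function.uncurry bp))
include hmeas

/-- The time integrand is nonnegative at every time and equals `+∞` on the non-null set of times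
where the irreversible rate is not purely plastic. -/
lemma phaseFunctional_of_not_constraints (hc : ¬B.Constraints z) :
    B.phaseFunctional bp z X = ⊤ := by
  have hnn : ∀ t, ((0 : ℝ) : EReal) ≤ B.phaseBHat bp (B.irrev z X t) (B.rate z t)
      - ((sympForm prodInner (B.irrev z X t) (B.rate z t) : ℝ) : EReal) := fun t => by
    by_cases hp : IsPlastic (B.irrev z X t)
    · rw [B.phaseBHat_of_isPlastic hbp hp, B.sympForm_of_isPlastic hp,
        B.reducedBHat_sub_inner hbp hmeas]
      exact EReal.coe_ennreal_nonneg _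
    · rw [B.phaseBHat_of_not_isPlastic hbp hp, EReal.top_sub_coe]
      exact le_top
  refine eIntegral_eq_top (integrable_zero _ _ _) hnn (s := {t | ¬IsPlastic (B.irrev z X t)})
    ?_ (fun h0 => hc (h.constraints_iff.2 h0)) fun t ht => ?_
  · have hm := h.aestronglyMeasurable_irrev
    have h1 : NullMeasurableSet {t | (B.irrev z X t).1.1 = 0} B.time :=
      (continuous_fst.fst.comp_aestronglyMeasurable hm).nullMeasurableSet_eq_fun
        aestronglyMeasurable_const
    have h2 : NullMeasurableSet {t | (B.irrev z X t).2.1 = 0} B.time :=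
      (continuous_snd.fst.comp_aestronglyMeasurable hm).nullMeasurableSet_eq_fun
        aestronglyMeasurable_const
    have h3 : NullMeasurableSet {t | (B.irrev z X t).2.2 = 0} B.time :=
      (continuous_snd.snd.comp_aestronglyMeasurable hm).nullMeasurableSet_eq_fun
        aestronglyMeasurable_const
    exact (h1.inter (h2.inter h3)).compl
  · rw [B.phaseBHat_of_not_isPlastic hbp ht, EReal.top_sub_coe]

lemma phaseFunctional_nonneg : 0 ≤ B.phaseFunctional bp z X := by
  by_cases hc : B.Constraints z
  · rw [h.phaseFunctional_of_constraints hbp hc]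
    exact B.functional_nonneg hbp hmeas _ _
  · rw [h.phaseFunctional_of_not_constraints hbp hmeas hc]
    exact le_top

lemma phaseFunctional_eq_zero_iff :
    B.phaseFunctional bp z X = 0 ↔ B.HamiltonianInclusion bp z X := by
  rw [h.hamiltonianInclusion_iff hbp]
  by_cases hc : B.Constraints z
  · rw [h.phaseFunctional_of_constraints hbp hc,
      B.functional_eq_zero_iff hbp hmeas h.disp.h1 h.stress_h1, and_iff_right hc]
  · rw [h.phaseFunctional_of_not_constraints hbp hmeas hc]
    simp [hc]

end IsPhasePath

lemma memLp_zField {a c : ℝ → VecField B.Ω} {b d : ℝ → TensField B.Ω} (ha : MemLp a 2 B.time)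
    (hb : MemLp b 2 B.time) (hc : MemLp c 2 B.time) (hd : MemLp d 2 B.time) :
    MemLp (fun t => (((a t, b t), (c t, d t)) : ZField B.Ω)) 2 B.time :=
  memLp_prodMk_prodMk ha hb hc hd

lemma IsPhasePath.isAdmissible {z : ℝ → ZState B.Ω} {X : ℝ → ZField B.Ω}
    (h : B.IsPhasePath z X) (hc : B.Constraints z) :
    B.IsAdmissible (fun t => (z t).1.1) (fun t => B.stress (z t)) where
  disp := h.disp
  h1 := h.stress_h1
  initial_disp := by rw [h.initial]
  initial_stress := by rw [h.initial]
  equilibrium := by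
    have hρ := B.ρ_pos.ne'
    -- The momentum is of class `H¹`, so `p/ρ` is the continuous representative of `u̇`.
    refine ⟨fun t => B.ρ⁻¹ • (z t).2.1, IsH1Path.clm (W := ZState B.Ω) (W' := VecField B.Ω) h.h1
      (B.ρ⁻¹ • B.momentumL), ?_, ?_, ?_⟩
    · filter_upwards [h.ae_deriv_disp, hc] with t h1 h2
      rw [h1, h2.1, inv_smul_smul₀ hρ]
      rfl
    · rw [smul_inv_smul₀ hρ, h.initial]
    · filter_upwards [hc, IsH1Path.deriv_clm (W := ZState B.Ω) (W' := VecField B.Ω) h.h1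
        (B.ρ⁻¹ • B.momentumL)] with t ⟨_, ⟨d, hd, hdp⟩, _⟩ h2
      have h2 : deriv (fun t => B.ρ⁻¹ • (z t).2.1) t = B.ρ⁻¹ • (B.rate z t).2.1 := h2
      exact ⟨d, hd, by rw [h2, smul_inv_smul₀ hρ, hdp]⟩

/-! ### Lifting admissible paths to phase space -/

section Lift

variable {u : ℝ → DispTriple B.Ω} {σ : ℝ → TensField B.Ω} {v : ℝ → VecField B.Ω}

/-- The path in phase space with displacement `u`, stress `σ`, velocity `v`, and the initial value
of `π` prescribed by the body. -/
noncomputable def phaseLift (B : Body) (u : ℝ → DispTriple B.Ω) (σ : ℝ → TensField B.Ω)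
    (v : ℝ → VecField B.Ω) (t : ℝ) : ZState B.Ω :=
  ((u t, (u t).2.1 - B.complianceL (σ t)), (B.ρ • v t, B.z₀.2.2 + ∫ s in (0 : ℝ)..t, σ s))

lemma stress_phaseLift (u : ℝ → DispTriple B.Ω) (σ : ℝ → TensField B.Ω) (v : ℝ → VecField B.Ω)
    (t : ℝ) : B.stress (B.phaseLift u σ v t) = σ t := by
  rw [stress_eq, phaseLift, sub_sub_cancel, elasticity_compliance]

lemma isH1Path_phaseLift (hu : IsH1Path B.T u) (hσ : IsH1Path B.T σ) (hv : IsH1Path B.T v) :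
    IsH1Path B.T (B.phaseLift u σ v) := by
  have hp : IsH1Path B.T (fun t => B.ρ • v t) :=
    IsH1Path.clm (W := VecField B.Ω) (W' := VecField B.Ω) hv
      (B.ρ • ContinuousLinearMap.id ℝ (VecField B.Ω))
  have hε : IsH1Path B.T (fun t => (u t).2.1 - B.complianceL (σ t)) :=
    IsH1Path.clm (W := DispTriple B.Ω × TensField B.Ω) (W' := TensField B.Ω) (hu.prodMk hσ)
      ((B.strainL.comp (ContinuousLinearMap.fst ℝ _ _)) -
        B.complianceL.comp (ContinuousLinearMap.snd ℝ _ _))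
  exact (hu.prodMk hε).prodMk (hp.prodMk (isH1Path_primitive hσ.continuousOn B.z₀.2.2))

lemma ae_rate_phaseLift (hu : IsH1Path B.T u) (hσ : IsH1Path B.T σ) (hv : IsH1Path B.T v) :
    ∀ᵐ t ∂B.time, (B.rate (B.phaseLift u σ v) t).1.1 = (deriv u t).1 ∧
      (B.rate (B.phaseLift u σ v) t).2.1 = B.ρ • deriv v t ∧
      (B.rate (B.phaseLift u σ v) t).2.2 = σ t := by
  filter_upwards [(isH1Path_phaseLift hu hσ hv).ae_hasDerivAt, hv.ae_hasDerivAt,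
    ae_hasDerivAt_primitive hσ.continuousOn B.z₀.2.2] with t h1 h2 h3
  have e : deriv u t = (deriv (B.phaseLift u σ v) t).1.1 :=
    (hasDerivAt_fst (hasDerivAt_fst h1)).deriv
  exact ⟨congrArg Prod.fst e.symm, (hasDerivAt_fst (hasDerivAt_snd h1)).unique (h2.const_smul B.ρ),
    (hasDerivAt_snd (hasDerivAt_snd h1)).unique h3⟩

lemma IsAdmissible.phaseLift_zero (h : B.IsAdmissible u σ) (hv : B.ρ • v 0 = B.z₀.2.1) :
    B.phaseLift u σ v 0 = B.z₀ := by
  have e : (u 0).2.1 - B.complianceL (σ 0) = B.z₀.1.2 := by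
    rw [h.initial_disp, h.initial_stress, stress_eq, compliance_elasticity, sub_sub_cancel]
  have e' : B.z₀.2.2 + ∫ s in (0 : ℝ)..0, σ s = B.z₀.2.2 := by
    rw [intervalIntegral.integral_same, add_zero]
  exact Prod.ext (Prod.ext h.initial_disp e) (Prod.ext hv e')

lemma memLp_gradient (hσ : IsH1Path B.T σ) (hv : IsH1Path B.T v) :
    MemLp (fun t => (((v t, 0), (B.ρ • deriv v t, σ t)) : ZField B.Ω)) 2 B.time := by
  have h1 : MemLp v 2 B.time := hv.memLp_self
  have h2 : MemLp (fun t => B.ρ • deriv v t) 2 B.time := hv.memLp.const_smul B.ρ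
  have h3 : MemLp σ 2 B.time := hσ.memLp_self
  exact memLp_zField h1 MemLp.zero h2 h3

/-- Every admissible path comes from a path in phase space which satisfies the constraints. -/
lemma IsAdmissible.exists_phasePath (h : B.IsAdmissible u σ) :
    ∃ z X, B.IsPhasePath z X ∧ B.Constraints z ∧
      (∀ t, u t = (z t).1.1) ∧ ∀ t, σ t = B.stress (z t) := by
  obtain ⟨v, hv, huv, hv0, heq⟩ := h.equilibrium
  -- The gradient is forced by `isSymplecticGradient_iff`. Writing its momentum component `d + f` as
  -- `ρ v̇` makes square integrability in time evident, since `d` is only given separately at almost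
  -- every time.
  refine ⟨B.phaseLift u σ v, fun t => ((v t, 0), (B.ρ • deriv v t, σ t)),
    ⟨isH1Path_phaseLift h.disp.h1 h.h1 hv, h.disp, h.phaseLift_zero hv0, ?_,
      memLp_gradient h.h1 hv⟩, ?_, fun t => rfl, fun t => (stress_phaseLift u σ v t).symm⟩
  · filter_upwards [heq] with t ⟨d, hd, hdv⟩
    rw [isSymplecticGradient_iff, stress_phaseLift]
    exact ⟨rfl, rfl, rfl, by rwa [← hdv, add_sub_cancel_right]⟩
  · filter_upwards [ae_rate_phaseLift h.disp.h1 h.h1 hv, huv, heq]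
      with t ⟨h1, h2, h3⟩ h4 ⟨d, hd, hdv⟩
    exact ⟨congrArg (B.ρ • ·) (h1.trans h4).symm, ⟨d, by rwa [stress_phaseLift], hdv.trans h2.symm⟩,
      h3.trans (stress_phaseLift u σ v t).symm⟩

end Lift

lemma isAdmissible_iff (u : ℝ → DispTriple B.Ω) (σ : ℝ → TensField B.Ω) :
    B.IsAdmissible u σ ↔ ∃ z X, B.IsPhasePath z X ∧ B.Constraints z ∧
      (∀ t, u t = (z t).1.1) ∧ ∀ t, σ t = B.stress (z t) := by
  refine ⟨IsAdmissible.exists_phasePath, ?_⟩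
  rintro ⟨z, X, h, hc, hu, hσ⟩
  rw [funext hu, funext hσ]
  exact h.isAdmissible hc

/-! ### Natural evolutions -/

section

variable (hbp : IsBipotential (fun e s : Sym3 => (inner ℝ e s : ℝ)) bp)
include hbp

/-- The inclusion contains the constraints, which make the path admissible; conversely, the lift of
an admissible path satisfies them, and the flow rule completes the inclusion. -/
lemma isNaturalEvolution_iff (u : ℝ → DispTriple B.Ω) (σ : ℝ → TensField B.Ω) :
    B.IsNaturalEvolution bp u σ ↔ B.IsAdmissible u σ ∧ B.FlowRule bp u σ := by
  constructor
  · rintro ⟨z, X, h, hi, hu, hσ⟩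
    rw [funext hu, funext hσ]
    obtain ⟨hc, hf⟩ := (h.hamiltonianInclusion_iff hbp).1 hi
    exact ⟨h.isAdmissible hc, hf⟩
  · rintro ⟨ha, hf⟩
    obtain ⟨z, X, h, hc, hu, hσ⟩ := ha.exists_phasePath
    refine ⟨z, X, h, (h.hamiltonianInclusion_iff hbp).2 ⟨hc, ?_⟩, hu, hσ⟩
    rwa [← funext hu, ← funext hσ]

lemma IsAdmissible.functional_eq_zero_iff (hmeas : Measurable (Function.uncurry bp))
    {u : ℝ → DispTriple B.Ω} {σ : ℝ → TensField B.Ω} (h : B.IsAdmissible u σ) :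
    B.functional bp u σ = 0 ↔ B.IsNaturalEvolution bp u σ := by
  rw [B.functional_eq_zero_iff hbp hmeas h.disp.h1 h.h1, isNaturalEvolution_iff hbp,
    and_iff_right h]

end

end Body

end SBEN

open SBEN in
/-- The symplectic Brezis-Ekeland-Nayroles principle for non associated plasticity. -/
theorem mainTheorem3 (B : Body) (bp : Sym3 → Sym3 → EReal)
    (hbp : IsBipotential (fun e s : Sym3 => (inner ℝ e s : ℝ)) bp)
    (hmeas : Measurable (Function.uncurry bp)) :
    -- the bipotential and the symplectic bipotential assembled from `bp`
    IsBipotential pairZ (bZ bp) ∧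
    IsSymplecticBipotential (prodInner : XPt → XPt → ℝ) (bHat bp) ∧
    -- the general principle in phase space for this symplectic bipotential
    (∀ z X, B.IsPhasePath z X →
      0 ≤ B.phaseFunctional bp z X ∧
      (B.phaseFunctional bp z X = 0 ↔ B.HamiltonianInclusion bp z X)) ∧
    -- its reduction to displacements and stresses
    (∀ z X, B.IsPhasePath z X →
      (B.Constraints z → B.phaseFunctional bp z X =
        B.functional bp (fun t => (z t).1.1) (fun t => B.stress (z t))) ∧
      (¬ B.Constraints z → B.phaseFunctional bp z X = ⊤)) ∧
    (∀ u σ, B.IsAdmissible u σ ↔ ∃ z X, B.IsPhasePath z X ∧ B.Constraints z ∧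
      (∀ t, u t = (z t).1.1) ∧ ∀ t, σ t = B.stress (z t)) ∧
    -- natural evolutions are the admissible paths which obey the flow rule
    (∀ u σ, B.IsNaturalEvolution bp u σ ↔ B.IsAdmissible u σ ∧ B.FlowRule bp u σ) ∧
    -- on admissible paths the functional is nonnegative and vanishes for natural evolutions only
    (∀ u σ, B.IsAdmissible u σ →
      0 ≤ B.functional bp u σ ∧ (B.functional bp u σ = 0 ↔ B.IsNaturalEvolution bp u σ)) ∧
    -- a natural evolution minimizes the functional among the admissible paths, and the minimum is 0
    (∀ u σ, B.IsNaturalEvolution bp u σ →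
      B.IsAdmissible u σ ∧ B.functional bp u σ = 0 ∧
      ∀ u' σ', B.IsAdmissible u' σ' → B.functional bp u σ ≤ B.functional bp u' σ') := by
  refine ⟨isBipotential_bZ hbp, isSymplecticBipotential_bHat hbp,
    fun z X h => ⟨h.phaseFunctional_nonneg hbp hmeas, h.phaseFunctional_eq_zero_iff hbp hmeas⟩,
    fun z X h => ⟨h.phaseFunctional_of_constraints hbp,
      h.phaseFunctional_of_not_constraints hbp hmeas⟩,
    Body.isAdmissible_iff, Body.isNaturalEvolution_iff hbp,
    fun u σ h => ⟨B.functional_nonneg hbp hmeas u σ, h.functional_eq_zero_iff hbp hmeas⟩,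
    fun u σ hn => ?_⟩
  have ha := ((Body.isNaturalEvolution_iff hbp u σ).1 hn).1
  have h0 := (ha.functional_eq_zero_iff hbp hmeas).2 hn
  exact ⟨ha, h0, fun u' σ' _ => h0 ▸ B.functional_nonneg hbp hmeas u' σ'⟩
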